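/- **Theorem.** Let $0\le h<1/10$ and $\Delta_h=\{x\in\mathbb R^2: 0\le x_1\le 2,\ x_2\ge -h\}$. For $z\in\{0,1\}\times\mathbb Z_{\ge0}$ let $\square_z=[z_1,z_1+1]\times[z_2,z_2+1]$ (the *bricks*). A *configuration* is a set $\eta\subset\{0,1\}\times\mathbb Z_{\ge 0}$ (the bricks still present); it is *well-filled* if its complement is finite. Put $\Delta_h^\eta=\Delta_h\setminus\bigcup_{z\in\eta}\square_z$, let $\Delta_h^{\mathcal O}$ be this set for the full configuration, and let $H(\eta)=\min\{z_2: z\in\eta\}$ be the height of the lowest brick present. The *breakout* is the following dynamics on triples (position, configuration, velocity). The state $(x,\eta,\theta)$ has unit velocity $v=(\cos\theta,\sin\theta)$ and is *admissible* if $x\in\Delta_h^\eta$ and $x+sv$ lies in the interior of $\Delta_h^\eta$ for all small $s>0$. The ball moves in a straight line at unit speed until it reaches the boundary of $\Delta_h^\eta$; there its velocity is reflected in the side that it meets (vertical or horizontal), and if that side belongs to a brick, this brick is removed from $\eta$; then the motion goes on in the new, larger table. The trajectory is stopped if it reaches a singular point (a corner of $\Delta_h$ or of a brick that is present at that time). An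 admissible state is *regular* if its trajectory never reaches a singular point and has finitely many collisions in bounded time, so that the state $\Phi_t^h(x,\eta,\theta)$ is defined for all $t\ge0$; write $H_t$ for $H$ of its configuration. Let $\theta_0$ satisfy $\tan\theta_0=1/4$ and let $\eta_0$ be a well-filled configuration. Then for Lebesgue-almost every $x_0\in\Delta_h^{\mathcal O}$ the state $(x_0,\eta_0,\theta_0)$ is regular and $$\lim_{t\to\infty}\frac{H_t}{\sqrt t}=\sqrt{\frac{1-4h}{\sqrt{17}}}.$$ If moreover $\sin\theta_0>0$, the same two assertions hold for initial positions on the floor, $x_0=(x_1,-h)$, for Lebesgue-almost every $x_1\in[0,2]$ such that $x_0\in\Delta_h^{\eta_0}$. -/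

import Mathlib

open Set Filter Topology MeasureTheory

noncomputable section

namespace Breakout

/-- The vertical half-strip of width `K` with floor at height `-h`. -/
def strip (K : ℕ) (h : ℝ) : Set (ℝ × ℝ) :=
  {x | 0 ≤ x.1 ∧ x.1 ≤ K ∧ -h ≤ x.2}

/-- Bricks are indexed by column (`0, …, K - 1`) and row (`0, 1, 2, …`); the brick of index `z`
is the closed unit square whose lower left corner is the integer point `z`. -/
def brick {K : ℕ} (z : Fin K × ℕ) : Set (ℝ × ℝ) :=
  Icc (z.1 : ℝ) ((z.1 : ℝ) + 1) ×ˢ Icc (z.2 : ℝ) ((z.2 : ℝ) + 1)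

/-- A configuration is the set of (indices of) bricks that are still present. -/
abbrev Config (K : ℕ) : Type := Set (Fin K × ℕ)

/-- A configuration is well-filled if only finitely many bricks are missing. -/
def WellFilled {K : ℕ} (η : Config K) : Prop := ηᶜ.Finite

/-- The billiard table of a configuration: the strip minus the bricks that are present. -/
def table {K : ℕ} (h : ℝ) (η : Config K) : Set (ℝ × ℝ) :=
  strip K h \ ⋃ z ∈ η, brick z

/-- Height of the lowest brick that is present. -/
def height {K : ℕ} (η : Config K) : ℕ := sInf {n | ∃ z ∈ η, z.2 = n}

/-- A state: position of the ball, its velocity, and the configuration. -/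
structure State (K : ℕ) where
  pos : ℝ × ℝ
  vel : ℝ × ℝ
  config : Config K

/-- The state with position `x`, configuration `η` and unit velocity of angle `θ`. -/
def State.ofAngle {K : ℕ} (x : ℝ × ℝ) (η : Config K) (θ : ℝ) : State K :=
  ⟨x, (Real.cos θ, Real.sin θ), η⟩

/-- The ball lies in the table and its velocity points strictly into the table. -/
def State.Admissible {K : ℕ} (h : ℝ) (s : State K) : Prop :=
  s.pos ∈ table h s.config ∧
    ∃ ε > 0, ∀ t, 0 < t → t < ε → s.pos + t • s.vel ∈ interior (table h s.config)

/-- Free flight during time `t`. -/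
def State.fly {K : ℕ} (s : State K) (t : ℝ) : State K :=
  { s with pos := s.pos + t • s.vel }

/-- First positive time at which the free flight meets the boundary of the table. -/
def State.hitTime {K : ℕ} (h : ℝ) (s : State K) : ℝ :=
  sInf {t | 0 < t ∧ s.pos + t • s.vel ∈ frontier (table h s.config)}

/-- Point of the boundary of the table at which the ball arrives next. -/
def State.hitPoint {K : ℕ} (h : ℝ) (s : State K) : ℝ × ℝ :=
  (s.fly (s.hitTime h)).pos

/-- Singular points: the two corners of the strip and the corners of the bricks present. -/
def vertices {K : ℕ} (h : ℝ) (η : Config K) : Set (ℝ × ℝ) :=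
  {p | (p.1 = 0 ∨ p.1 = K) ∧ p.2 = -h} ∪
  {p | ∃ z ∈ η, (p.1 = (z.1 : ℝ) ∨ p.1 = (z.1 : ℝ) + 1) ∧
    (p.2 = (z.2 : ℝ) ∨ p.2 = (z.2 : ℝ) + 1)}

/-- `p` lies on a vertical side: a lateral wall or a vertical side of a brick present. -/
def OnVertical {K : ℕ} (η : Config K) (p : ℝ × ℝ) : Prop :=
  p.1 = 0 ∨ p.1 = K ∨ ∃ z ∈ η, p ∈ brick z ∧ (p.1 = (z.1 : ℝ) ∨ p.1 = (z.1 : ℝ) + 1)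

/-- `p` lies on a horizontal side: the floor or a horizontal side of a brick present. -/
def OnHorizontal {K : ℕ} (h : ℝ) (η : Config K) (p : ℝ × ℝ) : Prop :=
  p.2 = -h ∨ ∃ z ∈ η, p ∈ brick z ∧ (p.2 = (z.2 : ℝ) ∨ p.2 = (z.2 : ℝ) + 1)

open Classical in
/-- The next collision: the ball flies to the boundary of the table, its velocity is reflected in
the side it meets, and if this is the side of a brick then that brick disappears. At a boundary
point of the table that is not a vertex exactly one of `OnVertical`, `OnHorizontal` holds, and
the point belongs to at most one brick. -/
def State.collide {K : ℕ} (h : ℝ) (s : State K) : State K where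
  pos := s.hitPoint h
  vel := (if OnVertical s.config (s.hitPoint h) then -s.vel.1 else s.vel.1,
    if OnHorizontal h s.config (s.hitPoint h) then -s.vel.2 else s.vel.2)
  config := {z ∈ s.config | s.hitPoint h ∉ brick z}

/-- The state just after the `n`-th collision (the initial state for `n = 0`). -/
def State.after {K : ℕ} (h : ℝ) (s : State K) (n : ℕ) : State K :=
  (State.collide h)^[n] s

/-- The time of the `n`-th collision (`0` for `n = 0`). -/
def State.time {K : ℕ} (h : ℝ) (s : State K) (n : ℕ) : ℝ :=
  ∑ k ∈ Finset.range n, (s.after h k).hitTime h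

/-- A regular state: admissible, and its trajectory is defined for all positive times, that is, it
never meets a singular point and has only finitely many collisions in bounded time. -/
def State.Regular {K : ℕ} (h : ℝ) (s : State K) : Prop :=
  s.Admissible h ∧
    (∀ n, (s.after h n).hitPoint h ∉ vertices h (s.after h n).config) ∧
    Tendsto (s.time h) atTop atTop

/-- The breakout semi-flow: the state at time `t ≥ 0`, obtained by free flight since the last
collision. It is right-continuous in `t`. Meaningful for regular initial states. -/
def flow {K : ℕ} (h : ℝ) (t : ℝ) (s : State K) : State K :=
  (s.after h (sSup {n : ℕ | s.time h n ≤ t})).fly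
    (t - s.time h (sSup {n : ℕ | s.time h n ≤ t}))

end Breakout

end

/-! Unfolding the lateral walls turns the abscissa into a phase modulo 4 (`foldX`). The slope is
1/4, so the phase advances by 4 per unit of vertical distance. Walls become invisible, floor and
undersides of bricks only flip the vertical direction, and a bounce off a brick side at x = 1 adds 2
to the phase. The two columns are the phase intervals (2i - 1, 2i + 1) with i even or odd.

A trip from row m to the floor and back adds 8m + 8h to the phase, which is 8h modulo 4, so
successive arrivals drift slowly across a column. Suppose that all rows from m on are full except
for the brick just hit. If the next arrival is in the same column, the ball enters the gap, destroys
the neighbouring brick from the side and hits row m + 1: the same picture one row higher. If the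
drift has carried it into the other column, the remaining brick is hit from below and a full row is
left; the round after that only opens a gap and gains no height. Column changes happen in a fraction
8h/2 = 4h of the rounds, so the mean gain is 1 - 4h rows per round. `Regime.step` makes this exact
with a quantity Q, twice the height up to a bounded error, that grows by 2 - 8h per round while the
round lasts √17 Q + O(1). After k rounds the height is about (1 - 4h)k and the time about √17 (1 -
4h)k², whence the limit (`tendsto_div_sqrt_of_sandwich`).

A well-filled configuration is brought to this regime because each bounce below the full rows
destroys one of finitely many bricks (`Along.exists_gapFrom`). Corners are avoided off countably
many lines, by the invariant behind `Generic`. -/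

noncomputable section

namespace Breakout

/-! ### Collisions, trajectories and genericity. -/

section Trajectory

variable {K : ℕ} {h : ℝ}

/-- Reflection of the velocity in the sides that contain the current position, together with the
removal of the bricks that contain it. -/
def State.reflect (h : ℝ) (s : State K) : State K :=
  open Classical in
  { pos := s.pos
    vel := (if OnVertical s.config s.pos then -s.vel.1 else s.vel.1,
      if OnHorizontal h s.config s.pos then -s.vel.2 else s.vel.2)
    config := {z ∈ s.config | s.pos ∉ brick z} }

theorem State.collide_eq (s : State K) :
    s.collide h = (s.fly (s.hitTime h)).reflect h := rfl

theorem State.fly_fly (s : State K) (a b : ℝ) : (s.fly a).fly b = s.fly (a + b) := by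
  simp only [State.fly, add_smul, add_assoc]

@[simp] theorem State.fly_zero (s : State K) : s.fly 0 = s := by
  simp [State.fly]

@[simp] theorem State.fly_config (s : State K) (a : ℝ) : (s.fly a).config = s.config := rfl

theorem State.hitTime_nonneg (s : State K) : 0 ≤ s.hitTime h :=
  Real.sInf_nonneg fun _ ht => ht.1.le

/-- A limit of interior points that is not interior lies on the frontier, so the first exit from the
interior realises the infimum. -/
theorem State.hitTime_eq (s : State K) {t : ℝ} (ht : 0 < t)
    (hin : ∀ q, 0 < q → q < t → (s.fly q).pos ∈ interior (table h s.config))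
    (hout : (s.fly t).pos ∉ interior (table h s.config)) : s.hitTime h = t := by
  have hcont : Continuous fun q : ℝ => (s.fly q).pos := by
    simp only [State.fly]; fun_prop
  have hcl : (s.fly t).pos ∈ closure (table h s.config) := by
    have hlim : Tendsto (fun q : ℝ => (s.fly q).pos) (𝓝[<] t) (𝓝 (s.fly t).pos) :=
      hcont.continuousAt.tendsto.mono_left nhdsWithin_le_nhds
    refine mem_closure_of_tendsto hlim ?_
    filter_upwards [Ioo_mem_nhdsLT ht] with q hq
    exact interior_subset (hin q hq.1 hq.2)
  apply le_antisymm
  · exact csInf_le ⟨0, fun _ h' => h'.1.le⟩ ⟨ht, hcl, hout⟩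
  · refine le_csInf ⟨t, ht, hcl, hout⟩ fun q hq => ?_
    by_contra! hlt
    exact hq.2.2 (hin q hq.1 hlt)

theorem State.after_succ (s : State K) (n : ℕ) :
    s.after h (n + 1) = (s.after h n).collide h := by
  simp only [State.after, Function.iterate_succ_apply']

theorem State.time_succ (s : State K) (n : ℕ) :
    s.time h (n + 1) = s.time h n + (s.after h n).hitTime h := by
  simp only [State.time, Finset.sum_range_succ]

theorem State.time_monotone (s : State K) : Monotone (s.time h) :=
  monotone_nat_of_le_succ fun n => by
    rw [State.time_succ]; linarith [State.hitTime_nonneg (h := h) (s.after h n)]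

theorem State.config_after_antitone (s : State K) : Antitone fun n => (s.after h n).config :=
  antitone_nat_of_succ_le fun n => by
    change (s.after h (n + 1)).config ⊆ _
    rw [State.after_succ]
    exact fun z hz => hz.1

/-- `s'` is the state just after some collision of the trajectory of `s`, at time `τ`. -/
def Reaches (h : ℝ) (s : State K) (τ : ℝ) (s' : State K) : Prop :=
  ∃ n, s.after h n = s' ∧ s.time h n = τ

/-- `s'` is the state of the trajectory of `s` at time `τ`. -/
def Along (h : ℝ) (s : State K) (τ : ℝ) (s' : State K) : Prop :=
  ∃ n r, 0 ≤ r ∧ s' = (s.after h n).fly r ∧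
    (∀ q, 0 < q → q ≤ r →
      ((s.after h n).fly q).pos ∈ interior (table h (s.after h n).config)) ∧
    τ = s.time h n + r

theorem Reaches.refl (s : State K) : Reaches h s 0 s := ⟨0, rfl, by simp [State.time]⟩

theorem Reaches.along {s s' : State K} {a : ℝ} (h₁ : Reaches h s a s') : Along h s a s' := by
  obtain ⟨m, rfl, rfl⟩ := h₁
  exact ⟨m, 0, le_rfl, by simp, fun q h1 h2 => absurd h1 (not_lt.2 h2), by simp⟩

theorem Along.fly {s s' : State K} {a t : ℝ} (h₁ : Along h s a s') (ht : 0 ≤ t)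
    (hin : ∀ q, 0 < q → q ≤ t → (s'.fly q).pos ∈ interior (table h s'.config)) :
    Along h s (a + t) (s'.fly t) := by
  obtain ⟨n, r, hr, rfl, hr', rfl⟩ := h₁
  refine ⟨n, r + t, by positivity, State.fly_fly _ _ _, fun q hq hq' => ?_, by ring⟩
  rcases le_or_gt q r with hqr | hqr
  · exact hr' q hq hqr
  · have := hin (q - r) (by linarith) (by linarith)
    rwa [State.fly_fly, add_sub_cancel, State.fly_config] at this

theorem Along.hit {s s' : State K} {a t : ℝ} (h₁ : Along h s a s') (ht : 0 < t)
    (hin : ∀ q, 0 < q → q < t → (s'.fly q).pos ∈ interior (table h s'.config))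
    (hout : (s'.fly t).pos ∉ interior (table h s'.config)) :
    Reaches h s (a + t) ((s'.fly t).reflect h) := by
  obtain ⟨n, r, hr, rfl, hr', rfl⟩ := h₁
  have hh : (s.after h n).hitTime h = r + t := by
    refine State.hitTime_eq _ (by linarith) (fun q hq hq' => ?_) ?_
    · rcases le_or_gt q r with hqr | hqr
      · exact hr' q hq hqr
      · have := hin (q - r) (by linarith) (by linarith)
        rwa [State.fly_fly, add_sub_cancel, State.fly_config] at this
    · rwa [State.fly_fly, State.fly_config] at hout
  refine ⟨n + 1, ?_, ?_⟩
  · rw [State.after_succ, State.collide_eq, hh, State.fly_fly]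
  · rw [State.time_succ, hh]; ring

theorem OnVertical.exists_int {η : Config K} {p : ℝ × ℝ} (hp : OnVertical η p) :
    ∃ k : ℤ, p.1 = k := by
  rcases hp with hp | hp | ⟨z, -, -, hp | hp⟩
  · exact ⟨0, by simpa using hp⟩
  · exact ⟨K, by simpa using hp⟩
  · exact ⟨(z.1 : ℕ), by simpa using hp⟩
  · exact ⟨(z.1 : ℕ) + 1, by simpa using hp⟩

theorem OnHorizontal.exists_int {η : Config K} {p : ℝ × ℝ} (hp : OnHorizontal h η p) :
    ∃ a b : ℤ, p.2 = a + h * b := by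
  rcases hp with hp | ⟨z, -, -, hp | hp⟩
  · exact ⟨0, -1, by simpa using hp⟩
  · exact ⟨z.2, 0, by simpa using hp⟩
  · exact ⟨z.2 + 1, 0, by simpa using hp⟩

/-- A state with velocity `(±4, ±1) / √17` whose line never meets a corner of the grid, even
after reflections in lines of the grid. -/
def Generic (h : ℝ) (s : State K) : Prop :=
  ∃ σ₁ σ₂ : ℝ, (σ₁ = 1 ∨ σ₁ = -1) ∧ (σ₂ = 1 ∨ σ₂ = -1) ∧
    s.vel = (σ₁ * (4 / √17), σ₂ * (1 / √17)) ∧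
    ∀ a b : ℤ, σ₁ * s.pos.1 - 4 * σ₂ * s.pos.2 ≠ a + 4 * h * b

/-- The velocity is proportional to (4σ₁, σ₂), so σ₁x - 4σ₂y is constant during free flight. -/
theorem Generic.fly {s : State K} (hs : Generic h s) (t : ℝ) : Generic h (s.fly t) := by
  obtain ⟨σ₁, σ₂, h₁, h₂, hv, hw⟩ := hs
  refine ⟨σ₁, σ₂, h₁, h₂, hv, fun a b hab => hw a b ?_⟩
  rw [← hab]
  simp only [State.fly, hv, Prod.fst_add, Prod.snd_add, Prod.smul_fst, Prod.smul_snd, smul_eq_mul]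
  rcases h₁ with rfl | rfl <;> rcases h₂ with rfl | rfl <;> ring

/-- All singular points have x in ℤ and y in ℤ + hℤ, where the invariant σ₁x - 4σ₂y would lie in ℤ +
4hℤ. -/
theorem Generic.not_corner {s : State K} (hs : Generic h s) {k a b : ℤ} (h₁ : s.pos.1 = k)
    (h₂ : s.pos.2 = a + h * b) : False := by
  obtain ⟨σ₁, σ₂, e₁, e₂, -, hw⟩ := hs
  rcases e₁ with rfl | rfl <;> rcases e₂ with rfl | rfl
  · exact hw (k - 4 * a) (-b) (by rw [h₁, h₂]; push_cast; ring)
  · exact hw (k + 4 * a) (b) (by rw [h₁, h₂]; push_cast; ring)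
  · exact hw (-k - 4 * a) (-b) (by rw [h₁, h₂]; push_cast; ring)
  · exact hw (-k + 4 * a) (b) (by rw [h₁, h₂]; push_cast; ring)

/-- A sign flip at x = k changes σ₁x by ±2k, and one at y = c + hd changes 4σ₂y by ±(8c + 8hd); both
changes stay in ℤ + 4hℤ. -/
theorem Generic.reflect {s : State K} (hs : Generic h s) : Generic h (s.reflect h) := by
  classical
  obtain ⟨σ₁, σ₂, h₁, h₂, hv, hw⟩ := hs
  refine ⟨if OnVertical s.config s.pos then -σ₁ else σ₁,
    if OnHorizontal h s.config s.pos then -σ₂ else σ₂, ?_, ?_, ?_, ?_⟩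
  · split_ifs <;> rcases h₁ with rfl | rfl <;> simp
  · split_ifs <;> rcases h₂ with rfl | rfl <;> simp
  · simp only [State.reflect, hv]
    split_ifs <;> simp
  · intro a b hab
    simp only [State.reflect] at hab
    have hx_shift : ∃ k : ℤ, (if OnVertical s.config s.pos then -σ₁ else σ₁) * s.pos.1 =
        σ₁ * s.pos.1 + k := by
      split_ifs with hV
      · obtain ⟨k, hk⟩ := hV.exists_int
        rcases h₁ with rfl | rfl
        · exact ⟨-2 * k, by rw [hk]; push_cast; ring⟩
        · exact ⟨2 * k, by rw [hk]; push_cast; ring⟩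
      · exact ⟨0, by simp⟩
    have hy_shift : ∃ c d : ℤ, 4 * (if OnHorizontal h s.config s.pos then -σ₂ else σ₂) * s.pos.2 =
        4 * σ₂ * s.pos.2 + c + 4 * h * d := by
      split_ifs with hH
      · obtain ⟨c, d, hk⟩ := hH.exists_int
        rcases h₂ with rfl | rfl
        · exact ⟨-8 * c, -2 * d, by rw [hk]; push_cast; ring⟩
        · exact ⟨8 * c, 2 * d, by rw [hk]; push_cast; ring⟩
      · exact ⟨0, 0, by simp⟩
    obtain ⟨k, hk⟩ := hx_shift
    obtain ⟨c, d, hc⟩ := hy_shift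
    rw [hk, hc] at hab
    exact hw (a - k + c) (b + d) (by push_cast; linarith)

theorem Generic.after {s : State K} (hs : Generic h s) (n : ℕ) : Generic h (s.after h n) := by
  induction n with
  | zero => exact hs
  | succ n ih => rw [State.after_succ, State.collide_eq]; exact (ih.fly _).reflect

theorem Generic.along {s s' : State K} {τ : ℝ} (hs : Generic h s) (hss : Along h s τ s') :
    Generic h s' := by
  obtain ⟨n, r, -, rfl, -⟩ := hss
  exact (hs.after n).fly r

theorem Generic.pos_notMem_vertices {s : State K} (hs : Generic h s) :
    s.pos ∉ vertices h s.config := by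
  rintro (⟨h₁, h₂⟩ | ⟨z, -, h₁, h₂⟩)
  · have h₂' : s.pos.2 = (0 : ℤ) + h * (-1 : ℤ) := by simpa using h₂
    rcases h₁ with h₁ | h₁
    · exact hs.not_corner (k := 0) (by simpa using h₁) h₂'
    · exact hs.not_corner (k := K) (by simpa using h₁) h₂'
  · obtain ⟨k, hk⟩ : ∃ k : ℤ, s.pos.1 = k := by
      rcases h₁ with h₁ | h₁
      · exact ⟨(z.1 : ℕ), by simpa using h₁⟩
      · exact ⟨(z.1 : ℕ) + 1, by simpa using h₁⟩
    rcases h₂ with h₂ | h₂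
    · exact hs.not_corner (a := z.2) (b := 0) hk (by simpa using h₂)
    · exact hs.not_corner (a := z.2 + 1) (b := 0) hk (by simpa using h₂)

theorem Generic.hitPoint_notMem_vertices {s : State K} (hs : Generic h s) (n : ℕ) :
    (s.after h n).hitPoint h ∉ vertices h (s.after h n).config :=
  ((hs.after n).fly ((s.after h n).hitTime h)).pos_notMem_vertices

theorem Generic.not_onHorizontal {s : State K} (hs : Generic h s)
    (hV : OnVertical s.config s.pos) : ¬ OnHorizontal h s.config s.pos := fun hH => by
  obtain ⟨k, hk⟩ := hV.exists_int
  obtain ⟨a, b, hab⟩ := hH.exists_int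
  exact hs.not_corner hk hab

theorem Generic.reflect_vertical {s : State K} (hs : Generic h s)
    (hV : OnVertical s.config s.pos) :
    s.reflect h = ⟨s.pos, (-s.vel.1, s.vel.2), {z ∈ s.config | s.pos ∉ brick z}⟩ := by
  simp [State.reflect, hV, hs.not_onHorizontal hV]

theorem Generic.reflect_horizontal {s : State K} (hs : Generic h s)
    (hH : OnHorizontal h s.config s.pos) :
    s.reflect h = ⟨s.pos, (s.vel.1, -s.vel.2), {z ∈ s.config | s.pos ∉ brick z}⟩ := by
  have hV : ¬ OnVertical s.config s.pos := fun hV => hs.not_onHorizontal hV hH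
  simp [State.reflect, hH, hV]

end Trajectory

/-! ### The interior of the table and the unfolding of the walls. -/

section

theorem mem_strip_of_mem_interior_table {K : ℕ} {h : ℝ} {η : Config K} {p : ℝ × ℝ}
    (hp : p ∈ interior (table h η)) : 0 < p.1 ∧ p.1 < K ∧ -h < p.2 := by
  have hs : strip K h = Icc (0 : ℝ) K ×ˢ Ici (-h) := by
    ext x; simp [strip, and_assoc]
  have : p ∈ interior (strip K h) := interior_mono sdiff_subset hp
  rw [hs, interior_prod_eq, interior_Icc, interior_Ici] at this
  exact ⟨this.1.1, this.1.2, this.2⟩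

theorem notMem_interior_table_of_mem_brick {K : ℕ} {h : ℝ} {η : Config K} {p : ℝ × ℝ}
    {z : Fin K × ℕ} (hz : z ∈ η) (hp : p ∈ brick z) : p ∉ interior (table h η) := fun hi =>
  (interior_subset hi).2 (mem_biUnion hz hp)

theorem mem_interior_table_of_rectangle {K : ℕ} {h : ℝ} {η : Config K} {p : ℝ × ℝ}
    {a b c d : ℝ} (h₁ : a < p.1) (h₂ : p.1 < b) (h₃ : c < p.2) (h₄ : p.2 < d)
    (hsub : ∀ x y, a < x → x < b → c < y → y < d → (x, y) ∈ table h η) :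
    p ∈ interior (table h η) := by
  refine mem_interior.2 ⟨Ioo a b ×ˢ Ioo c d, ?_, isOpen_Ioo.prod isOpen_Ioo, ⟨⟨h₁, h₂⟩, h₃, h₄⟩⟩
  rintro ⟨x, y⟩ ⟨hx, hy⟩
  exact hsub x y hx.1 hx.2 hy.1 hy.2

/-- No brick is left in the rows below `m`. -/
def EmptyBelow (η : Config 2) (m : ℕ) : Prop := ∀ z ∈ η, m ≤ z.2

variable {h : ℝ} {η : Config 2} {m : ℕ}

theorem EmptyBelow.notMem_brick (hη : EmptyBelow η m) {p : ℝ × ℝ} (hp : p.2 < m) :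
    ∀ z ∈ η, p ∉ brick z := fun z hz hb => by
  have h1 : (m : ℝ) ≤ z.2 := by exact_mod_cast hη z hz
  have h2 := hb.2.1
  linarith

theorem EmptyBelow.mem_interior (hη : EmptyBelow η m) {p : ℝ × ℝ} (h₁ : 0 < p.1)
    (h₂ : p.1 < 2) (h₃ : -h < p.2) (h₄ : p.2 < m) : p ∈ interior (table h η) := by
  refine mem_interior_table_of_rectangle h₁ h₂ h₃ h₄ fun x y hx hx' hy hy' => ?_
  refine ⟨⟨hx.le, by simpa using hx'.le, hy.le⟩, ?_⟩
  simp only [mem_iUnion, not_exists]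
  exact fun z hz => hη.notMem_brick hy' z hz

theorem fin_two_cast_eq (c : Fin 2) : (c : ℝ) = 0 ∨ (c : ℝ) = 1 := by
  fin_cases c <;> simp

theorem fin_two_eq_of_lt {c d : Fin 2} {x : ℝ} (h₁ : (c : ℝ) < x) (h₂ : x < (c : ℝ) + 1)
    (h₃ : (d : ℝ) ≤ x) (h₄ : x ≤ (d : ℝ) + 1) : d = c := by
  fin_cases c <;> fin_cases d <;> simp at * <;> linarith

theorem EmptyBelow.eq_of_mem_brick (hη : EmptyBelow η m) {c : Fin 2} {p : ℝ × ℝ}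
    (h₁ : (c : ℝ) < p.1) (h₂ : p.1 < (c : ℝ) + 1) (h₄ : p.2 < m + 1) {z : Fin 2 × ℕ}
    (hz : z ∈ η) (hp : p ∈ brick z) : z = (c, m) := by
  have h5 := hp.2.1
  have h6 : z.2 < m + 1 := by
    have : (z.2 : ℝ) < (m : ℝ) + 1 := h5.trans_lt h₄
    exact_mod_cast this
  exact Prod.ext (fin_two_eq_of_lt h₁ h₂ hp.1.1 hp.1.2) (le_antisymm (by omega) (hη z hz))

theorem EmptyBelow.mem_interior_column (hη : EmptyBelow η m) {c : Fin 2} (hc : (c, m) ∉ η)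
    {p : ℝ × ℝ} (h₁ : (c : ℝ) < p.1) (h₂ : p.1 < (c : ℝ) + 1) (h₃ : -h < p.2)
    (h₄ : p.2 < m + 1) : p ∈ interior (table h η) := by
  refine mem_interior_table_of_rectangle h₁ h₂ h₃ h₄ fun x y hx hx' hy hy' => ?_
  refine ⟨⟨?_, ?_, hy.le⟩, ?_⟩
  · rcases fin_two_cast_eq c with h | h <;> rw [h] at hx <;> simp only <;> linarith
  · rcases fin_two_cast_eq c with h | h <;> rw [h] at hx' <;> simp only <;> push_cast <;> linarith
  · simp only [mem_iUnion, not_exists]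
    intro z hz hb
    exact hc (hη.eq_of_mem_brick (p := (x, y)) hx hx' hy' hz hb ▸ hz)

/-- Abscissa of the ball as a function of the phase: a triangle wave of period `4`. -/
def foldX (φ : ℝ) : ℝ := if Even ⌊φ / 2⌋ then φ - 2 * ⌊φ / 2⌋ else 2 * ⌊φ / 2⌋ + 2 - φ

/-- Horizontal direction of the ball as a function of the phase. -/
def dirX (φ : ℝ) : ℝ := if Even ⌊φ / 2⌋ then 1 else -1

theorem floor_half_eq {φ : ℝ} {j : ℤ} (h₁ : 2 * j ≤ φ) (h₂ : φ < 2 * j + 2) : ⌊φ / 2⌋ = j := by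
  rw [Int.floor_eq_iff]; constructor <;> linarith

theorem floor_half_le (φ : ℝ) : 2 * (⌊φ / 2⌋ : ℝ) ≤ φ := by
  linarith [Int.floor_le (φ / 2)]

theorem lt_floor_half (φ : ℝ) : φ < 2 * (⌊φ / 2⌋ : ℝ) + 2 := by
  linarith [Int.lt_floor_add_one (φ / 2)]

theorem dirX_eq {φ : ℝ} {j : ℤ} (h₁ : 2 * j ≤ φ) (h₂ : φ < 2 * j + 2) :
    dirX φ = if Even j then 1 else -1 := by
  rw [dirX, floor_half_eq h₁ h₂]

/-- The right endpoint is allowed because the triangle wave is continuous, unlike `dirX`; a straight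
piece may thus end on a wall. -/
theorem foldX_eq {φ : ℝ} {j : ℤ} (h₁ : 2 * j ≤ φ) (h₂ : φ ≤ 2 * j + 2) :
    foldX φ = if Even j then φ - 2 * j else 2 * j + 2 - φ := by
  rcases h₂.lt_or_eq with h₂ | h₂
  · rw [foldX, floor_half_eq h₁ h₂]
  · have : ⌊φ / 2⌋ = j + 1 := floor_half_eq (by push_cast; linarith) (by push_cast; linarith)
    rw [foldX, this, h₂]
    by_cases hj : Even j
    · have : ¬ Even (j + 1) := by simpa [Int.even_add_one] using hj
      simp only [hj, this, if_true, if_false]; push_cast; ring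
    · have : Even (j + 1) := by simpa [Int.even_add_one] using hj
      simp only [hj, this, if_true, if_false]; push_cast; ring

theorem foldX_pos {φ : ℝ} {j : ℤ} (h₁ : 2 * j < φ) (h₂ : φ < 2 * j + 2) : 0 < foldX φ := by
  rw [foldX_eq h₁.le h₂.le]; split_ifs <;> linarith

theorem foldX_lt_two {φ : ℝ} {j : ℤ} (h₁ : 2 * j < φ) (h₂ : φ < 2 * j + 2) : foldX φ < 2 := by
  rw [foldX_eq h₁.le h₂.le]; split_ifs <;> linarith

/-- The state at height `y` and phase `φ` that moves upwards (`σ = 1`) or downwards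
(`σ = -1`). -/
def unfolded (φ y σ : ℝ) (η : Config 2) : State 2 :=
  ⟨(foldX φ, y), (dirX φ * (4 / √17), σ * (1 / √17)), η⟩

/-- The vertical speed is 1/√17, so pieces of trajectory are measured by vertical distance `e`, with
duration √17 e and phase increment 4e. -/
theorem unfolded_fly_pos {φ y σ e : ℝ} {j : ℤ} (h₁ : 2 * j ≤ φ) (he : 0 ≤ e)
    (h₂ : φ + 4 * e ≤ 2 * j + 2) (h₃ : φ < 2 * j + 2) :
    ((unfolded φ y σ η).fly (√17 * e)).pos = (foldX (φ + 4 * e), y + σ * e) := by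
  have h17 : (√17 : ℝ) ≠ 0 := by positivity
  ext
  · simp only [State.fly, unfolded, Prod.fst_add, Prod.smul_fst, smul_eq_mul]
    rw [dirX_eq h₁ h₃, foldX_eq h₁ h₃.le, foldX_eq (by linarith) h₂]
    split_ifs <;> field_simp <;> ring
  · simp only [State.fly, unfolded, Prod.snd_add, Prod.smul_snd, smul_eq_mul]
    field_simp

theorem unfolded_fly {φ y σ e : ℝ} {j : ℤ} (h₁ : 2 * j ≤ φ) (he : 0 ≤ e)
    (h₂ : φ + 4 * e < 2 * j + 2) :
    (unfolded φ y σ η).fly (√17 * e) = unfolded (φ + 4 * e) (y + σ * e) σ η := by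
  have := unfolded_fly_pos (η := η) (y := y) (σ := σ) h₁ he h₂.le (by linarith)
  simp only [State.fly, unfolded] at this ⊢
  rw [this, dirX_eq (φ := φ) h₁ (by linarith), dirX_eq (φ := φ + 4 * e) (by linarith) h₂]

theorem Along.leg {s : State 2} {τ φ y σ e : ℝ} {j : ℤ} (hA : Along h s τ (unfolded φ y σ η))
    (h₁ : 2 * j ≤ φ) (he : 0 ≤ e) (h₂ : φ + 4 * e < 2 * j + 2)
    (hin : ∀ e', 0 < e' → e' ≤ e → (foldX (φ + 4 * e'), y + σ * e') ∈ interior (table h η)) :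
    Along h s (τ + √17 * e) (unfolded (φ + 4 * e) (y + σ * e) σ η) := by
  rw [← unfolded_fly h₁ he h₂]
  refine hA.fly (by positivity) fun q hq hq' => ?_
  have h17 : (0 : ℝ) < √17 := by positivity
  obtain ⟨e', rfl⟩ : ∃ e', q = √17 * e' := ⟨q / √17, by field_simp⟩
  have he' : 0 < e' := pos_of_mul_pos_right hq h17.le
  have he'' : e' ≤ e := le_of_mul_le_mul_left hq' h17
  rw [unfolded_fly_pos h₁ he'.le (by linarith) (by linarith)]
  exact hin e' he' he''

theorem Along.leg_hit {s : State 2} {τ φ y σ e : ℝ} {j : ℤ}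
    (hA : Along h s τ (unfolded φ y σ η))
    (h₁ : 2 * j ≤ φ) (he : 0 < e) (h₂ : φ + 4 * e ≤ 2 * j + 2)
    (hin : ∀ e', 0 < e' → e' < e → (foldX (φ + 4 * e'), y + σ * e') ∈ interior (table h η))
    (hout : (foldX (φ + 4 * e), y + σ * e) ∉ interior (table h η)) :
    Reaches h s (τ + √17 * e) (((unfolded φ y σ η).fly (√17 * e)).reflect h) := by
  have h17 : (0 : ℝ) < √17 := by positivity
  refine hA.hit (by positivity) (fun q hq hq' => ?_) ?_
  · obtain ⟨e', rfl⟩ : ∃ e', q = √17 * e' := ⟨q / √17, by field_simp⟩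
    have he' : 0 < e' := pos_of_mul_pos_right hq h17.le
    have he'' : e' < e := lt_of_mul_lt_mul_left hq' h17.le
    rw [unfolded_fly_pos h₁ he'.le (by linarith) (by linarith)]
    exact hin e' he' he''
  · rw [unfolded_fly_pos h₁ he.le h₂ (by linarith)]
    exact hout

theorem Along.hit_vertical {s : State 2} {τ φ y σ e : ℝ} {j : ℤ} (hs : Generic h s)
    (hA : Along h s τ (unfolded φ y σ η))
    (h₁ : 2 * j ≤ φ) (he : 0 < e) (h₂ : φ + 4 * e ≤ 2 * j + 2)
    (hin : ∀ e', 0 < e' → e' < e → (foldX (φ + 4 * e'), y + σ * e') ∈ interior (table h η))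
    (hout : (foldX (φ + 4 * e), y + σ * e) ∉ interior (table h η))
    (hV : OnVertical η (foldX (φ + 4 * e), y + σ * e)) :
    Reaches h s (τ + √17 * e) ⟨(foldX (φ + 4 * e), y + σ * e),
      (-(dirX φ * (4 / √17)), σ * (1 / √17)),
      {z ∈ η | (foldX (φ + 4 * e), y + σ * e) ∉ brick z}⟩ := by
  have := hA.leg_hit h₁ he h₂ hin hout
  have hpos := unfolded_fly_pos (η := η) (y := y) (σ := σ) h₁ he.le h₂ (by linarith)
  rw [((hs.along hA).fly (√17 * e)).reflect_vertical (by rw [hpos]; exact hV), hpos] at this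
  exact this

theorem Along.hit_horizontal {s : State 2} {τ φ y σ e : ℝ} {j : ℤ} (hs : Generic h s)
    (hA : Along h s τ (unfolded φ y σ η))
    (h₁ : 2 * j ≤ φ) (he : 0 < e) (h₂ : φ + 4 * e < 2 * j + 2)
    (hin : ∀ e', 0 < e' → e' < e → (foldX (φ + 4 * e'), y + σ * e') ∈ interior (table h η))
    (hout : (foldX (φ + 4 * e), y + σ * e) ∉ interior (table h η))
    (hH : OnHorizontal h η (foldX (φ + 4 * e), y + σ * e)) :
    Reaches h s (τ + √17 * e) (unfolded (φ + 4 * e) (y + σ * e) (-σ)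
      {z ∈ η | (foldX (φ + 4 * e), y + σ * e) ∉ brick z}) := by
  have := hA.leg_hit h₁ he h₂.le hin hout
  have hpos := unfolded_fly_pos (η := η) (y := y) (σ := σ) h₁ he.le h₂.le (by linarith)
  rw [((hs.along hA).fly (√17 * e)).reflect_horizontal (by rw [hpos]; exact hH), hpos] at this
  simp only [State.fly, unfolded] at this ⊢
  rwa [dirX_eq (φ := φ) h₁ (by linarith), ← neg_mul,
    ← dirX_eq (φ := φ + 4 * e) (by linarith) h₂] at this

/-- Walls sit at the even phases, exactly where `dirX` changes sign, so the reflection is absorbed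
by the unfolding and the phase simply runs on. -/
theorem Along.hit_wall {s : State 2} {τ φ y σ e : ℝ} {j : ℤ} (hs : Generic h s)
    (hA : Along h s τ (unfolded φ y σ η))
    (h₁ : 2 * j ≤ φ) (he : 0 < e) (h₂ : φ + 4 * e = 2 * (j + 1 : ℤ))
    (hin : ∀ e', 0 < e' → e' < e → (foldX (φ + 4 * e'), y + σ * e') ∈ interior (table h η))
    (hb : ∀ z ∈ η, (foldX (φ + 4 * e), y + σ * e) ∉ brick z) :
    Reaches h s (τ + √17 * e) (unfolded (φ + 4 * e) (y + σ * e) σ η) := by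
  have h₂' : φ + 4 * e ≤ 2 * j + 2 := by rw [h₂]; push_cast; linarith
  have hx : foldX (φ + 4 * e) = 0 ∨ foldX (φ + 4 * e) = 2 := by
    rw [foldX_eq (by linarith) h₂', h₂]; push_cast
    split_ifs
    · right; ring
    · left; ring
  have := hA.hit_vertical hs h₁ he h₂' hin ?_ ?_
  · convert this using 1
    rw [sep_eq_self_iff_mem_true.2 fun z hz => by simpa using hb z hz]
    simp only [unfolded]
    congr 2
    rw [← neg_mul, dirX_eq (φ := φ) h₁ (by linarith),
      dirX_eq (j := j + 1) (by rw [h₂]) (by rw [h₂]; linarith)]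
    simp only [Int.even_add_one]
    split_ifs <;> simp
  · intro hp
    have := mem_strip_of_mem_interior_table hp
    simp only [Nat.cast_ofNat] at this
    rcases hx with hx | hx <;> linarith
  · rcases hx with hx | hx
    · exact Or.inl hx
    · exact Or.inr (Or.inl (by simpa using hx))

end

/-! ### Flights between the floor and the lowest row. -/

section

variable {h : ℝ} {η : Config 2} {m : ℕ} {s : State 2} {τ φ y : ℝ}

/-- Modulo integers, `dirX φ * foldX φ` is the phase itself, so genericity says that φ - 4σy avoids
ℤ + 4hℤ. Hence the ball is never at x = 0, 1, 2 when it is level with the floor or a row boundary.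
-/
theorem Generic.phase_ne_int {σ d : ℝ} (hg : Generic h (unfolded φ y σ η)) {a b : ℤ}
    (hσ : σ = 1 ∨ σ = -1) (hd : y + σ * d = a + h * b) (k : ℤ) : φ + 4 * d ≠ k := by
  intro hk
  obtain ⟨σ₁, σ₂, -, -, hv, hw⟩ := hg
  have h17 : (√17 : ℝ) ≠ 0 := by positivity
  have hv1 : dirX φ = σ₁ := by
    have := congrArg Prod.fst hv
    simpa [unfolded, h17] using this
  have hv2 : σ = σ₂ := by
    have := congrArg Prod.snd hv
    simpa [unfolded, h17] using this
  subst hv1 hv2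
  have hx : ∃ l : ℤ, dirX φ * foldX φ = φ + l := by
    unfold dirX foldX
    split_ifs
    · exact ⟨-2 * ⌊φ / 2⌋, by push_cast; ring⟩
    · exact ⟨-2 * ⌊φ / 2⌋ - 2, by push_cast; ring⟩
  obtain ⟨l, hl⟩ := hx
  simp only [unfolded] at hw
  rcases hσ with rfl | rfl
  · exact hw (k + l - 4 * a) (-b) (by push_cast; linarith)
  · exact hw (k + l + 4 * a) b (by push_cast; linarith)

/-- Free flight between the walls, up to the last straight piece. -/
theorem Along.last_leg (hs : Generic h s) (hη : EmptyBelow η m) {σ d : ℝ}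
    (hA : Along h s τ (unfolded φ y σ η)) (hd : 0 < d)
    (hreg : ∀ e, 0 < e → e < d → -h < y + σ * e ∧ y + σ * e < m)
    (hne : ∀ k : ℤ, φ + 4 * d ≠ k) :
    ∃ d', 0 ≤ d' ∧ d' < d ∧
      Along h s (τ + √17 * d') (unfolded (φ + 4 * d') (y + σ * d') σ η) ∧
      φ + 4 * d < 2 * ⌊(φ + 4 * d') / 2⌋ + 2 := by
  -- Induction on the number of even phases passed, that is, of wall hits.
  obtain ⟨n, hn⟩ : ∃ n : ℕ, ⌊(φ + 4 * d) / 2⌋ = ⌊φ / 2⌋ + n :=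
    Int.le.dest (Int.floor_mono (by linarith)) |>.imp fun _ h => h.symm
  induction n generalizing φ y d τ with
  | zero =>
    refine ⟨0, le_rfl, hd, by simpa using hA, ?_⟩
    have := lt_floor_half (φ + 4 * d)
    rw [hn] at this
    simpa using this
  | succ n ih =>
    set j := ⌊φ / 2⌋ with hj
    have h1 : (2 * j : ℝ) ≤ φ := floor_half_le φ
    have h2 : φ < 2 * j + 2 := lt_floor_half φ
    have h3 : (2 * j + 2 : ℝ) ≤ φ + 4 * d := by
      have := floor_half_le (φ + 4 * d)
      rw [hn] at this
      push_cast at this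
      have h0 : (0 : ℝ) ≤ n := n.cast_nonneg
      linarith
    set e := (2 * j + 2 - φ) / 4 with he
    have he0 : 0 < e := by rw [he]; linarith
    have hed : e < d := by
      have := hne (2 * j + 2)
      push_cast at this
      have := lt_of_le_of_ne h3 this.symm
      rw [he]; linarith
    have heq : φ + 4 * e = 2 * (j + 1 : ℤ) := by rw [he]; push_cast; ring
    have hw := hA.hit_wall hs h1 he0 heq (fun e' h1' h2' => ?_) ?_
    · have hfl : ⌊(φ + 4 * e) / 2⌋ = j + 1 :=
        floor_half_eq (by rw [heq]) (by rw [heq]; linarith)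
      obtain ⟨d', h4, h5, h6, h7⟩ := ih (d := d - e) hw.along (by linarith)
        (fun e' h1' h2' => by
          have := hreg (e + e') (by linarith) (by linarith)
          rwa [mul_add, ← add_assoc] at this)
        (fun k hk => hne k (by rw [← hk]; ring))
        (by rw [hfl, show φ + 4 * e + 4 * (d - e) = φ + 4 * d by ring, hn]; push_cast; ring)
      refine ⟨e + d', by linarith, by linarith, ?_, ?_⟩
      · convert h6 using 1
        · ring
        · congr 1 <;> ring
      · rwa [show φ + 4 * e + 4 * (d - e) = φ + 4 * d by ring,
          show φ + 4 * e + 4 * d' = φ + 4 * (e + d') by ring] at h7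
    · have hr := hreg e' h1' (by linarith)
      refine hη.mem_interior ?_ ?_ hr.1 hr.2
      · exact foldX_pos (j := j) (by linarith) (by push_cast at heq; linarith)
      · exact foldX_lt_two (j := j) (by linarith) (by push_cast at heq; linarith)
    · exact hη.notMem_brick (hreg e he0 hed).2

/-- The ball comes down to the floor and is reflected there. -/
theorem Along.floor (hs : Generic h s) (hη : EmptyBelow η m)
    (hA : Along h s τ (unfolded φ y (-1) η)) (hy : -h < y) (hm : y ≤ m) :
    Reaches h s (τ + √17 * (y + h)) (unfolded (φ + 4 * (y + h)) (-h) 1 η) := by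
  have hne := (hs.along hA).phase_ne_int (d := y + h) (a := 0) (b := -1) (Or.inr rfl)
    (by push_cast; ring)
  obtain ⟨d', h1, h2, h3, h4⟩ := hA.last_leg hs hη (d := y + h) (by linarith)
    (fun e h1 h2 => ⟨by linarith, by linarith⟩) hne
  have hx1 := floor_half_le (φ + 4 * d')
  have e1 : φ + 4 * d' + 4 * (y + h - d') = φ + 4 * (y + h) := by ring
  have e2 : y + -1 * d' + -1 * (y + h - d') = -h := by ring
  have := h3.hit_horizontal hs hx1 (e := y + h - d') (by linarith) (by linarith)
    (fun e' h1' h2' => hη.mem_interior (foldX_pos (by linarith) (by linarith))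
      (foldX_lt_two (by linarith) (by linarith)) (by simp only; linarith)
      (by simp only; linarith)) ?_ ?_
  · rw [e1, e2, neg_neg, sep_eq_self_iff_mem_true.2 fun z hz => by
      simpa using hη.notMem_brick (p := (_, -h)) (by simp only; linarith) z hz] at this
    convert this using 1
    ring
  · intro hp
    have := (mem_strip_of_mem_interior_table hp).2.2
    simp only at this
    linarith
  · exact Or.inl e2

/-- Column that contains the abscissa of phase `φ`. -/
def column (φ : ℝ) : Fin 2 := if foldX φ < 1 then 0 else 1

/-- Phase 2i is the outer wall of a column, x = 0 for even i and x = 2 for odd i. Centring there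
makes each passage through a column a single phase interval, wall bounce included. -/
theorem foldX_eq_abs {i : ℤ} (h₁ : 2 * i - 1 ≤ φ) (h₂ : φ ≤ 2 * i + 1) :
    foldX φ = if Even i then |φ - 2 * i| else 2 - |φ - 2 * i| := by
  rcases le_total (2 * i : ℝ) φ with h | h
  · rw [foldX_eq h (by linarith), abs_of_nonneg (by linarith)]
    split_ifs <;> ring
  · rw [foldX_eq (j := i - 1) (by push_cast; linarith) (by push_cast; linarith),
      abs_of_nonpos (by linarith)]
    by_cases hi : Even i
    · have : ¬ Even (i - 1) := by simpa [Int.even_sub_one] using hi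
      simp only [hi, this, if_true, if_false]; push_cast; ring
    · have : Even (i - 1) := by simpa [Int.even_sub_one] using hi
      simp only [hi, this, if_true, if_false]; push_cast; ring

theorem column_eq {i : ℤ} (h₁ : 2 * i - 1 < φ) (h₂ : φ < 2 * i + 1) :
    column φ = if Even i then 0 else 1 := by
  have : |φ - 2 * i| < 1 := abs_lt.2 ⟨by linarith, by linarith⟩
  rw [column, foldX_eq_abs h₁.le h₂.le]
  by_cases hi : Even i
  · simp [hi, this]
  · simp only [hi, if_false]; rw [if_neg (by linarith)]

theorem exists_column_index (hφ : ∀ k : ℤ, φ ≠ k) : ∃ i : ℤ, 2 * i - 1 < φ ∧ φ < 2 * i + 1 := by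
  refine ⟨⌊(φ + 1) / 2⌋, ?_, ?_⟩
  · have := floor_half_le (φ + 1)
    refine lt_of_le_of_ne (by linarith) fun h => hφ (2 * ⌊(φ + 1) / 2⌋ - 1) ?_
    push_cast; exact h.symm
  · linarith [lt_floor_half (φ + 1)]

theorem foldX_mem_column {i : ℤ} (h₁ : 2 * i - 1 < φ) (h₂ : φ < 2 * i + 1) (h₃ : φ ≠ 2 * i) :
    ((if Even i then 0 else 1 : Fin 2) : ℝ) < foldX φ ∧
      foldX φ < ((if Even i then 0 else 1 : Fin 2) : ℝ) + 1 := by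
  have h4 : |φ - 2 * i| < 1 := abs_lt.2 ⟨by linarith, by linarith⟩
  have h5 : 0 < |φ - 2 * i| := abs_pos.2 (sub_ne_zero.2 h₃)
  rw [foldX_eq_abs h₁.le h₂.le]
  split_ifs
  · simp only [Fin.val_zero, Nat.cast_zero]; constructor <;> linarith
  · simp only [Fin.val_one, Nat.cast_one]; constructor <;> linarith

theorem column_lt_foldX (hφ : ∀ k : ℤ, φ ≠ k) :
    (column φ : ℝ) < foldX φ ∧ foldX φ < (column φ : ℝ) + 1 := by
  obtain ⟨i, h1, h2⟩ := exists_column_index hφ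
  rw [column_eq h1 h2]
  exact foldX_mem_column h1 h2 (by simpa using hφ (2 * i))

/-- The ball comes up to the lower side of a brick of the lowest row. -/
theorem Along.brick_bottom (hs : Generic h s) (hη : EmptyBelow η m)
    (hA : Along h s τ (unfolded φ y 1 η)) (hy : -h ≤ y) (hm : y < m)
    (hc : (column (φ + 4 * (m - y)), m) ∈ η) :
    Reaches h s (τ + √17 * (m - y))
      (unfolded (φ + 4 * (m - y)) m (-1) (η \ {(column (φ + 4 * (m - y)), m)})) := by
  have hne := (hs.along hA).phase_ne_int (d := m - y) (a := m) (b := 0) (Or.inl rfl)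
    (by push_cast; ring)
  obtain ⟨d', h1, h2, h3, h4⟩ := hA.last_leg hs hη (d := m - y) (by linarith)
    (fun e h1 h2 => ⟨by linarith, by linarith⟩) hne
  have hx1 := floor_half_le (φ + 4 * d')
  have e1 : φ + 4 * d' + 4 * (m - y - d') = φ + 4 * (m - y) := by ring
  have e2 : y + 1 * d' + 1 * (m - y - d') = m := by ring
  obtain ⟨hl, hr⟩ := column_lt_foldX hne
  have hbr : (foldX (φ + 4 * (m - y)), (m : ℝ)) ∈ brick (column (φ + 4 * (m - y)), m) :=
    ⟨⟨hl.le, hr.le⟩, le_rfl, by simp⟩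
  have := h3.hit_horizontal hs hx1 (e := m - y - d') (by linarith) (by linarith)
    (fun e' h1' h2' => hη.mem_interior (foldX_pos (by linarith) (by linarith))
      (foldX_lt_two (by linarith) (by linarith)) (by simp only; linarith)
      (by simp only; linarith)) ?_ ?_
  · rw [e1, e2] at this
    convert this using 1
    · ring
    · congr 1
      ext z
      simp only [Set.mem_sdiff, mem_singleton_iff, mem_ofPred_eq]
      refine and_congr_right fun hz => not_congr ⟨fun h => h ▸ hbr, fun hb => ?_⟩
      exact hη.eq_of_mem_brick hl hr (by simp) hz hb
  · rw [e1, e2]; exact notMem_interior_table_of_mem_brick hc hbr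
  · rw [e1, e2]; exact Or.inr ⟨_, hc, hbr, Or.inl rfl⟩

/-- The ball comes up to a gap of the lowest row. -/
theorem Along.gap (hs : Generic h s) (hη : EmptyBelow η m)
    (hA : Along h s τ (unfolded φ y 1 η)) (hy : -h ≤ y) (hm : y ≤ m)
    (hc : (column (φ + 4 * (m - y)), m) ∉ η) :
    Along h s (τ + √17 * (m - y)) (unfolded (φ + 4 * (m - y)) m 1 η) := by
  rcases hm.eq_or_lt with hm' | hm'
  · convert hA using 1
    · rw [hm']; ring
    · congr 1
      · rw [hm']; ring
      · exact hm'.symm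
  have hne := (hs.along hA).phase_ne_int (d := m - y) (a := m) (b := 0) (Or.inl rfl)
    (by push_cast; ring)
  obtain ⟨d', h1, h2, h3, h4⟩ := hA.last_leg hs hη (d := m - y) (by linarith)
    (fun e h1 h2 => ⟨by linarith, by linarith⟩) hne
  have hx1 := floor_half_le (φ + 4 * d')
  have e1 : φ + 4 * d' + 4 * (m - y - d') = φ + 4 * (m - y) := by ring
  have e2 : y + 1 * d' + 1 * (m - y - d') = m := by ring
  obtain ⟨hl, hr⟩ := column_lt_foldX hne
  have := h3.leg hx1 (e := m - y - d') (by linarith) (by linarith) fun e' h1' h2' => ?_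
  · rw [e1, e2] at this
    convert this using 1
    ring
  · rcases h2'.eq_or_lt with rfl | h2'
    · rw [e1, e2]
      exact hη.mem_interior_column hc hl hr (by simp only; linarith) (by simp)
    · exact hη.mem_interior (foldX_pos (by linarith) (by linarith))
        (foldX_lt_two (by linarith) (by linarith)) (by simp only; linarith)
        (by simp only; linarith)

/-- The ball comes up to a gap of the lowest row, turns at the remaining brick of this row, which
disappears, and goes on upwards. -/
theorem Along.gap_side (hs : Generic h s) (hη : EmptyBelow η m)
    (hA : Along h s τ (unfolded φ y 1 η)) (hy : -h ≤ y) (hm : y ≤ m)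
    (hc : (column (φ + 4 * (m - y)), m) ∉ η) {c : Fin 2} (hc' : (c, m) ∈ η) :
    ∃ y', (m : ℝ) < y' ∧ y' < m + 1 ∧
      Reaches h s (τ + √17 * (y' - y))
        (unfolded (φ + 4 * (y' - y) + 2) y' 1 {z ∈ η | m + 1 ≤ z.2}) := by
  have hne := (hs.along hA).phase_ne_int (d := m - y) (a := m) (b := 0) (Or.inl rfl)
    (by push_cast; ring)
  have hB := hA.gap hs hη hy hm hc
  obtain ⟨i, hi1, hi2⟩ := exists_column_index hne
  set ψ := φ + 4 * (m - y) with hψ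
  rw [column_eq hi1 hi2] at hc
  have hψi : ψ ≠ 2 * i := by simpa using hne (2 * i)
  have hcol : ∀ φ' y' : ℝ, 2 * i - 1 < φ' → φ' < 2 * i + 1 → φ' ≠ 2 * i → (m : ℝ) < y' → y' < m + 1 →
      (foldX φ', y') ∈ interior (table h η) := fun φ' y' h1 h2 h3 h4 h5 =>
    hη.mem_interior_column hc (foldX_mem_column h1 h2 h3).1 (foldX_mem_column h1 h2 h3).2
      (by simp only; linarith) h5
  -- reach the phase interval `[2 * i, 2 * i + 1)`
  obtain ⟨e₁, he₁, hψ₁, hψ₂, hC⟩ : ∃ e₁, 0 ≤ e₁ ∧ 2 * i ≤ ψ + 4 * e₁ ∧ ψ + 4 * e₁ < 2 * i + 1 ∧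
      Along h s (τ + √17 * (m - y) + √17 * e₁) (unfolded (ψ + 4 * e₁) (m + 1 * e₁) 1 η) := by
    rcases lt_or_gt_of_ne hψi with hlt | hgt
    -- The ball still moves outwards, so it first bounces off the outer wall; no brick is touched
    -- there, the column being empty in row m.
    · have heq : ψ + 4 * ((2 * i - ψ) / 4) = 2 * ((i - 1) + 1 : ℤ) := by push_cast; ring
      have heq' : ψ + 4 * ((2 * i - ψ) / 4) = 2 * i := by ring
      refine ⟨(2 * i - ψ) / 4, by linarith, by linarith, by linarith, Reaches.along ?_⟩
      refine hB.hit_wall hs (j := i - 1) (by push_cast; linarith) (by linarith) heq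
        (fun e' h1 h2 => hcol _ _ (by linarith) (by linarith) (by linarith) (by linarith)
          (by linarith)) fun z hz hb => ?_
      rw [heq'] at hb
      have hx := foldX_eq_abs (φ := 2 * i) (i := i) (by linarith) (by linarith)
      rw [sub_self, abs_zero, sub_zero] at hx
      have hz2 : z.2 = m := by
        have h5 := hb.2.1
        have h6 : z.2 < m + 1 := by
          have : (z.2 : ℝ) < (m : ℝ) + 1 := by simp only at h5; linarith
          exact_mod_cast this
        exact le_antisymm (by omega) (hη z hz)
      have h7 := hb.1
      simp only [hx] at h7
      suffices h9 : z = (if Even i then 0 else 1, m) from hc (h9 ▸ hz)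
      refine Prod.ext ?_ hz2
      split_ifs at h7 ⊢
      · rcases fin_two_cast_eq z.1 with h8 | h8
        · ext; simpa using h8
        · rw [h8] at h7; exact absurd h7.1 (by norm_num)
      · rcases fin_two_cast_eq z.1 with h8 | h8
        · rw [h8] at h7; exact absurd h7.2 (by norm_num)
        · ext; simpa using h8
    · exact ⟨0, le_rfl, by linarith, by linarith, by simpa using hB⟩
  set φ₁ := ψ + 4 * e₁ with hφ₁
  have hy₁ : ψ + 4 * e₁ < 2 * i + 1 := hψ₂
  -- The line x = 1 is met at phase 2i + 1. From ψ > 2i - 1 the rise inside the gap is less than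
  -- 1/2, so the side that is hit belongs to row m.
  set e := (2 * i + 1 - φ₁) / 4 with he
  have e1 : φ₁ + 4 * e = 2 * i + 1 := by rw [he]; ring
  have he0 : 0 < e := by linarith
  have hem : (m : ℝ) < m + 1 * e₁ + 1 * e ∧ m + 1 * e₁ + 1 * e < (m : ℝ) + 1 := by
    constructor <;> linarith
  have hx : foldX (2 * i + 1) = 1 := by
    rw [foldX_eq (j := i) (by linarith) (by linarith)]; split_ifs <;> ring
  have hb : ((1 : ℝ), m + 1 * e₁ + 1 * e) ∈ brick (c, m) := by
    refine ⟨?_, hem.1.le, hem.2.le⟩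
    rcases fin_two_cast_eq c with h8 | h8 <;> simp only [h8] <;> constructor <;> norm_num
  refine ⟨m + 1 * e₁ + 1 * e, hem.1, hem.2, ?_⟩
  have hH := hC.hit_vertical hs hψ₁ he0 (by linarith)
    (fun e' h1 h2 => hcol _ _ (by linarith) (by linarith) (by linarith) (by linarith)
      (by linarith)) ?_ ?_
  · rw [e1, hx] at hH
    convert hH using 1
    · ring
    -- Phases 2i + 1 and 2i + 3 both fold to x = 1 with opposite directions, so reflection in the
    -- side is a phase shift by 2.
    · have e2 : φ + 4 * (m + 1 * e₁ + 1 * e - y) + 2 = 2 * (i + 1 : ℤ) + 1 := by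
        push_cast; linarith
      rw [e2, unfolded, foldX_eq (j := i + 1) (by linarith) (by linarith),
        dirX_eq (j := i + 1) (by linarith) (by linarith), dirX_eq hψ₁ (by linarith)]
      congr 1
      · congr 1
        split_ifs <;> ring
      · congr 1
        simp only [Int.even_add_one]
        split_ifs <;> simp
      · ext z
        simp only [mem_ofPred_eq]
        refine and_congr_right fun hz => ⟨fun h1 h2 => ?_, fun h1 => ?_⟩
        · have h3 := h2.2.1
          have : ((m + 1 : ℕ) : ℝ) ≤ z.2 := by exact_mod_cast h1
          push_cast at this
          simp only at h3
          linarith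
        · by_contra! h2
          have hz2 : z.2 = m := le_antisymm (by omega) (hη z hz)
          have : z = (c, m) := by
            refine Prod.ext ?_ hz2
            by_contra hne'
            have : z.1 ≠ (if Even i then 0 else 1 : Fin 2) := fun h3 =>
              hc (by rw [← h3, ← hz2]; exact hz)
            have : c ≠ (if Even i then 0 else 1 : Fin 2) := fun h3 => hc (by rw [← h3]; exact hc')
            simp only at hne'
            omega
          exact h1 (this ▸ hb)
  · rw [e1, hx]; exact notMem_interior_table_of_mem_brick hc' hb
  · rw [e1, hx]
    refine Or.inr (Or.inr ⟨_, hc', hb, ?_⟩)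
    rcases fin_two_cast_eq c with h8 | h8 <;> simp [h8]

end

/-! ### Reaching the periodic pattern, and its rounds. -/

section

variable {h : ℝ} {η : Config 2} {m : ℕ} {s : State 2} {τ φ y : ℝ}

/-- On its way up the ball clears the rows that it crosses, and it finally meets the lower side of
a brick. -/
theorem Along.exists_bounce (hs : Generic h s) {N : ℕ} (hN : ∀ z : Fin 2 × ℕ, N ≤ z.2 → z ∈ η)
    (hη : EmptyBelow η m) (hmN : m ≤ N) (hA : Along h s τ (unfolded φ y 1 η)) (hy : -h ≤ y)
    (hm : y ≤ m) (hstart : y < m ∨ (column (φ + 4 * (m - y)), m) ∉ η) :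
    ∃ (τ' φ' : ℝ) (b : ℕ), b ≤ N ∧ -h < b ∧ (column φ', b) ∈ η ∧
      Reaches h s τ' (unfolded φ' b (-1) ({z ∈ η | b ≤ z.2} \ {(column φ', b)})) := by
  obtain ⟨k, hk⟩ := Nat.exists_eq_add_of_le hmN
  induction k generalizing m η τ φ y with
  | zero =>
    have hc : (column (φ + 4 * (m - y)), m) ∈ η := hN _ (by simp [hk])
    have hlt := hstart.resolve_right (not_not.2 hc)
    refine ⟨τ + √17 * (m - y), _, m, hmN, by linarith, hc, ?_⟩
    rw [sep_eq_self_iff_mem_true.2 fun z hz => by simpa using hη z hz]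
    exact hA.brick_bottom hs hη hy hlt hc
  | succ k ih =>
    by_cases hc : (column (φ + 4 * (m - y)), m) ∈ η
    · have hlt := hstart.resolve_right (not_not.2 hc)
      refine ⟨τ + √17 * (m - y), _, m, hmN, by linarith, hc, ?_⟩
      rw [sep_eq_self_iff_mem_true.2 fun z hz => by simpa using hη z hz]
      exact hA.brick_bottom hs hη hy hlt hc
    by_cases hc' : ∃ c, (c, m) ∈ η
    · obtain ⟨c, hc'⟩ := hc'
      obtain ⟨y', h1, h2, h3⟩ := hA.gap_side hs hη hy hm hc hc'
      obtain ⟨τ', φ', b, h4, h5, h6, h7⟩ := ih (m := m + 1)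
        (η := {z ∈ η | m + 1 ≤ z.2}) (fun z hz => ⟨hN z hz, by omega⟩) (fun z hz => hz.2)
        (by omega) h3.along (by linarith)
        (by push_cast; linarith) (Or.inl (by push_cast; linarith)) (by omega)
      refine ⟨τ', φ', b, h4, h5, h6.1, ?_⟩
      have hb : m + 1 ≤ b := h6.2
      convert h7 using 3
      ext z
      simp only [mem_ofPred_eq]
      exact ⟨fun hz => ⟨⟨hz.1, hb.trans hz.2⟩, hz.2⟩, fun hz => ⟨hz.1.1, hz.2⟩⟩
    -- Row m is already empty, so the same state serves with m + 1 in place of m.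
    · push Not at hc'
      refine ih (m := m + 1) hN (fun z hz => ?_) (by omega) hA hy (by push_cast; linarith)
        (Or.inl (by push_cast; linarith)) (by omega)
      refine lt_of_le_of_ne (hη z hz) fun h => hc' z.1 ?_
      rw [h]; exact hz

/-- All rows from `m` on. -/
def fullFrom (m : ℕ) : Config 2 := {z | m ≤ z.2}

/-- All rows from `m` on, except for one brick of row `m`. -/
def gapFrom (m : ℕ) (c : Fin 2) : Config 2 := fullFrom m \ {(c, m)}

theorem height_fullFrom (m : ℕ) : height (fullFrom m) = m := by
  refine le_antisymm (Nat.sInf_le ⟨(0, m), le_refl m, rfl⟩) ?_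
  refine le_csInf ⟨m, (0, m), le_refl m, rfl⟩ ?_
  rintro _ ⟨z, hz, rfl⟩
  exact hz

theorem height_gapFrom (m : ℕ) (c : Fin 2) : height (gapFrom m c) = m := by
  have hmem : m ∈ {n | ∃ z ∈ gapFrom m c, z.2 = n} :=
    ⟨(c + 1, m), ⟨le_refl m, by simp⟩, rfl⟩
  refine le_antisymm (Nat.sInf_le hmem) (le_csInf ⟨m, hmem⟩ ?_)
  rintro _ ⟨z, hz, rfl⟩
  exact hz.1

/-- The ball eventually starts from the floor below a completely filled half-strip in which only
the brick that was hit last is missing. -/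
theorem Along.exists_gapFrom (hs : Generic h s) {N : ℕ}
    (hN : ∀ z : Fin 2 × ℕ, N ≤ z.2 → z ∈ η) (hη : EmptyBelow η m) (hmN : m ≤ N)
    (hA : Along h s τ (unfolded φ y 1 η)) (hy : -h ≤ y)
    (hm : y ≤ m) (hstart : y < m ∨ (column (φ + 4 * (m - y)), m) ∉ η) :
    ∃ τ' φ' : ℝ, -h < N ∧ Along h s τ' (unfolded φ' N (-1) (gapFrom N (column φ'))) := by
  -- Induction on the number of bricks below row N: a bounce at a row b < N removes one of them and
  -- sends the ball back to the floor.
  obtain ⟨k, hk⟩ : ∃ k, {z ∈ η | z.2 < N}.ncard = k := ⟨_, rfl⟩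
  induction k using Nat.strong_induction_on generalizing m η τ φ y with
  | _ k ih =>
    obtain ⟨τ', φ', b, h4, h5, h6, h7⟩ := hA.exists_bounce hs hN hη hmN hy hm hstart
    rcases h4.eq_or_lt with rfl | h4
    · refine ⟨τ', φ', h5, ?_⟩
      convert h7.along using 3
      ext z
      exact ⟨fun hz => ⟨⟨hN z hz.1, hz.1⟩, hz.2⟩, fun hz => ⟨hz.1.2, hz.2⟩⟩
    · set η' : Config 2 := {z ∈ η | b ≤ z.2} \ {(column φ', b)} with hη'
      have hη'b : EmptyBelow η' b := fun z hz => hz.1.2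
      refine ih _ ?_ (η := η') ?_ hη'b h4.le (h7.along.floor hs hη'b h5 le_rfl).along le_rfl
        h5.le (Or.inl h5) rfl
      · rw [← hk]
        refine ncard_lt_ncard ?_ ?_
        · have hsub : {z ∈ η' | z.2 < N} ⊆ {z ∈ η | z.2 < N} := fun z hz => ⟨hz.1.1.1, hz.2⟩
          refine (ssubset_iff_of_subset hsub).2 ⟨(column φ', b), And.intro h6 h4, ?_⟩
          exact fun hz => hz.1.2 rfl
        · exact ((finite_univ (α := Fin 2)).prod (finite_Iio N)).subset fun z hz =>
            ⟨mem_univ _, hz.2⟩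
      · refine fun z hz => ⟨⟨hN z hz, h4.le.trans hz⟩, fun hz' => ?_⟩
        rw [mem_singleton_iff] at hz'
        rw [hz'] at hz
        exact absurd h4 (not_lt.2 hz)

/-- The states in which the ball leaves the floor below a half-strip with a complete lowest row,
or with a lowest row from which the brick that was hit last is missing. The parameter `Q` is
twice the height up to a bounded error, and it grows linearly with the number of rounds. -/
def Regime (h Q : ℝ) (s : State 2) : Prop :=
  (∃ (m : ℕ) (i : ℤ) (φ : ℝ), -h < m ∧ 2 * i - 1 < φ ∧ φ < 2 * i + 1 ∧
    s = unfolded (φ + 4 * (m + h)) (-h) 1 (gapFrom m (column φ)) ∧ Q = 2 * m - (φ - 2 * i)) ∨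
  (∃ (m : ℕ) (i : ℤ) (φ : ℝ), -h < m ∧ 2 * i - 1 < φ ∧ φ < 2 * i - 1 + 8 * h ∧
    s = unfolded (φ + 4 * (m - 1 + h)) (-h) 1 (fullFrom m) ∧ Q = 2 * m - 2 - (φ - 2 * i))

theorem Regime.abs_height_sub_le {Q : ℝ} (h_lt : h < 1 / 10) (hQ : Regime h Q s) :
    |2 * (height s.config : ℝ) - Q| ≤ 3 := by
  rcases hQ with ⟨m, i, φ, -, h1, h2, rfl, rfl⟩ | ⟨m, i, φ, -, h1, h2, rfl, rfl⟩
  · simp only [unfolded, height_gapFrom]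
    rw [abs_le]; constructor <;> linarith
  · simp only [unfolded, height_fullFrom]
    rw [abs_le]; constructor <;> linarith

theorem Regime.config_nonempty {Q : ℝ} (hQ : Regime h Q s) : s.config.Nonempty := by
  rcases hQ with ⟨m, i, φ, -, -, -, rfl, -⟩ | ⟨m, i, φ, -, -, -, rfl, -⟩
  · exact ⟨(0, m + 1), Nat.le_succ m, by simp⟩
  · exact ⟨(0, m), le_refl m⟩

theorem emptyBelow_gapFrom (m : ℕ) (c : Fin 2) : EmptyBelow (gapFrom m c) m := fun _ hz => hz.1

theorem emptyBelow_fullFrom (m : ℕ) : EmptyBelow (fullFrom m) m := fun _ hz => hz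

theorem gapFrom_sdiff {c d : Fin 2} (hcd : c ≠ d) :
    gapFrom m c \ {(d, m)} = fullFrom (m + 1) := by
  ext ⟨z, n⟩
  simp only [gapFrom, fullFrom, Set.mem_sdiff, mem_ofPred_eq, mem_singleton_iff, Prod.mk.injEq]
  constructor
  · rintro ⟨⟨h1, h2⟩, h3⟩
    refine lt_of_le_of_ne h1 ?_
    rintro rfl
    simp only [and_true] at h2 h3
    omega
  · intro h1
    exact ⟨⟨by omega, by omega⟩, by omega⟩

/-- In `Regime`, φ is the phase of the last hit from below, at height m in the gap case and m - 1 in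
the full case, and δ = φ - 2i is its offset in the column. Every round adds 8h to δ, less 2 when the
column changes. The extra -2 of Q in the full case offsets that recentring and the following round
without gain, so that Q always increases by 2 - 8h. -/
theorem Regime.step {Q : ℝ} (h_nonneg : 0 ≤ h) (h_lt : h < 1 / 10) (hs : Generic h s)
    {s' : State 2} (hR : Reaches h s τ s') (hQ : Regime h Q s') :
    ∃ (τ' : ℝ) (s'' : State 2), Reaches h s τ' s'' ∧ Regime h (Q + (2 - 8 * h)) s'' ∧
      |τ' - τ - √17 * Q| ≤ 4 * √17 := by
  have h17 : (0 : ℝ) < √17 := by positivity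
  have htime : ∀ x : ℝ, |x - Q| ≤ 4 → |√17 * x - √17 * Q| ≤ 4 * √17 := fun x hx => by
    rw [← mul_sub, abs_mul, abs_of_pos h17]; nlinarith
  have hg := hs.along hR.along
  rcases hQ with ⟨m, i, φ, hm, h1, h2, rfl, rfl⟩ | ⟨m, i, φ, hm, h1, h2, rfl, rfl⟩
  · have h4 : Even (4 * m : ℤ) := ⟨2 * m, by ring⟩
    have hne := hg.phase_ne_int (d := m + h) (a := m) (b := 0) (Or.inl rfl)
      (by push_cast; ring)
    have e1 : φ + 4 * (m + h) + 4 * (m - -h) = φ + 8 * m + 8 * h := by ring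
    have e1' : φ + 4 * (m + h) + 4 * (m + h) = φ + 8 * m + 8 * h := by ring
    rw [e1'] at hne
    -- Either the drifted arrival is still in the column of the gap, or it has passed to the other
    -- column.
    rcases lt_or_ge (φ + 8 * h) (2 * i + 1) with hlt | hge
    · have hcol : column (φ + 8 * m + 8 * h) = column φ := by
        rw [column_eq (φ := φ + 8 * m + 8 * h) (i := i + 4 * m)
          (by push_cast; linarith) (by push_cast; linarith),
          column_eq h1 h2]
        simp [Int.even_add, h4]
      obtain ⟨y', hy1, hy2, hy3⟩ := hR.along.gap_side (c := column φ + 1) hs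
        (emptyBelow_gapFrom m _) le_rfl hm.le (by rw [e1, hcol]; simp [gapFrom])
        (by simp [gapFrom, fullFrom])
      have hcfg : {z ∈ gapFrom m (column φ) | m + 1 ≤ z.2} = fullFrom (m + 1) := by
        ext z
        refine ⟨fun hz => hz.2, fun hz => ⟨⟨Nat.le_of_succ_le hz, ?_⟩, hz⟩⟩
        rintro rfl
        exact absurd (show m + 1 ≤ m from hz) (by simp)
      rw [hcfg] at hy3
      have hb := hy3.along.brick_bottom hs (emptyBelow_fullFrom (m + 1)) (by linarith)
        (by push_cast; linarith) (by simp [fullFrom])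
      have hf := hb.along.floor hs (emptyBelow_gapFrom (m + 1) _) (by push_cast; linarith) le_rfl
      -- The phase gains 8m + 8h for the trip, 4 for the extra row and 2 for the side reflection;
      -- the centre moves by 8m + 6, leaving the offset δ + 8h.
      refine ⟨_, _, hf, Or.inl ⟨m + 1, i + 4 * m + 3,
        φ + 8 * m + 8 * h + 6, by push_cast; linarith, by push_cast; linarith,
        by push_cast; linarith, ?_, ?_⟩, ?_⟩
      · have e2 : φ + 4 * (m + h) + 4 * (y' - -h) + 2 + 4 * (((m + 1 : ℕ) : ℝ) - y') =
          φ + 8 * m + 8 * h + 6 := by push_cast; ring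
        rw [e2]
      · push_cast; ring
      · convert htime (2 * (m + 1 : ℕ) + 2 * h) ?_ using 2
        · ring
        · push_cast; rw [abs_le]; constructor <;> linarith
    -- Equality would put the ball at an integer phase at height m, hence at a corner.
    · have hgt : 2 * i + 1 < φ + 8 * h := by
        refine lt_of_le_of_ne hge fun h => hne (2 * i + 1 + 8 * m) ?_
        push_cast; linarith
      have hcol : column φ ≠ column (φ + 8 * m + 8 * h) := by
        rw [column_eq (φ := φ + 8 * m + 8 * h) (i := i + 4 * m + 1)
          (by push_cast; linarith) (by push_cast; linarith),
          column_eq h1 h2]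
        by_cases hi : Even i <;> simp [hi, h4, Int.even_add]
      have hb := hR.along.brick_bottom hs (emptyBelow_gapFrom m _) le_rfl hm
        (by rw [e1]; simp [gapFrom, fullFrom, hcol.symm])
      rw [e1, gapFrom_sdiff hcol] at hb
      have hf := hb.along.floor hs (emptyBelow_fullFrom (m + 1)) hm (by push_cast; linarith)
      refine ⟨_, _, hf, Or.inr ⟨m + 1, i + 4 * m + 1, φ + 8 * m + 8 * h, by push_cast; linarith,
        by push_cast; linarith, by push_cast; linarith, ?_, ?_⟩, ?_⟩
      · congr 1; push_cast; ring
      · push_cast; ring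
      · convert htime (2 * m + 2 * h) ?_ using 2
        · ring
        · rw [abs_le]; constructor <;> linarith
  · have e1 : φ + 4 * (m - 1 + h) + 4 * (m - -h) = φ + 8 * m - 4 + 8 * h := by ring
    have hb := hR.along.brick_bottom hs (emptyBelow_fullFrom m) le_rfl hm (by simp [fullFrom])
    rw [e1] at hb
    have hf := hb.along.floor hs (emptyBelow_gapFrom m _) hm le_rfl
    -- The new offset δ + 8h is below -1 + 16h, which is less than 1, so the hit stays in the column
    -- interval.
    refine ⟨_, _, hf, Or.inl ⟨m, i + 4 * m - 2, φ + 8 * m - 4 + 8 * h, hm,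
      by push_cast; linarith, by push_cast; linarith, rfl, ?_⟩, ?_⟩
    · push_cast; ring
    · convert htime (2 * m + 2 * h) ?_ using 2
      · ring
      · rw [abs_le]; constructor <;> linarith

/-- From some time on the trajectory consists of rounds between the floor and the lowest row. -/
theorem Regime.exists_sequence {Q : ℝ} (h_nonneg : 0 ≤ h) (h_lt : h < 1 / 10) (hs : Generic h s)
    {s' : State 2} (hR : Reaches h s τ s') (hQ : Regime h Q s') :
    ∃ n : ℕ → ℕ, ∀ k : ℕ, (s.after h (n k)).config.Nonempty ∧
      |2 * (height (s.after h (n k)).config : ℝ) - (Q + (2 - 8 * h) * k)| ≤ 3 ∧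
      |s.time h (n (k + 1)) - s.time h (n k) - √17 * (Q + (2 - 8 * h) * k)| ≤ 4 * √17 := by
  -- Pairs of Q and collision index; iterating a choice function for `Regime.step` yields the
  -- rounds.
  let X := {p : ℝ × ℕ // Regime h p.1 (s.after h p.2)}
  have hstep : ∀ x : X, ∃ x' : X, x'.1.1 = x.1.1 + (2 - 8 * h) ∧
      |s.time h x'.1.2 - s.time h x.1.2 - √17 * x.1.1| ≤ 4 * √17 := fun x => by
    obtain ⟨τ', s'', ⟨n, rfl, rfl⟩, h2, h3⟩ := Regime.step h_nonneg h_lt hs ⟨x.1.2, rfl, rfl⟩ x.2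
    exact ⟨⟨(_, n), h2⟩, rfl, h3⟩
  choose f hf₁ hf₂ using hstep
  obtain ⟨n₀, rfl, -⟩ := hR
  let x : ℕ → X := fun k => f^[k] ⟨(Q, n₀), hQ⟩
  have hx : ∀ k, x (k + 1) = f (x k) := fun k => Function.iterate_succ_apply' _ _ _
  have hQk : ∀ k : ℕ, (x k).1.1 = Q + (2 - 8 * h) * k := fun k => by
    induction k with
    | zero => simp [x]
    | succ k ih => rw [hx, hf₁, ih]; push_cast; ring
  refine ⟨fun k => (x k).1.2, fun k => ⟨(x k).2.config_nonempty, ?_, ?_⟩⟩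
  · rw [← hQk]; exact (x k).2.abs_height_sub_le h_lt
  · rw [← hQk]; simp only [hx]; exact hf₂ (x k)

end

/-! ### Asymptotics of height and time. -/

section

theorem tendsto_div_of_abs_sub_le {u : ℕ → ℝ} {a C : ℝ} {p : ℕ}
    (hu : ∀ k : ℕ, 1 ≤ k → |u k - a * (k : ℝ) ^ (p + 1)| ≤ C * (k : ℝ) ^ p) :
    Tendsto (fun k : ℕ => u k / (k : ℝ) ^ (p + 1)) atTop (𝓝 a) := by
  rw [tendsto_iff_norm_sub_tendsto_zero]
  refine squeeze_zero' (Eventually.of_forall fun _ => norm_nonneg _) ?_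
    (tendsto_const_div_atTop_nhds_zero_nat C)
  filter_upwards [eventually_ge_atTop 1] with k hk
  have hk0 : (0 : ℝ) < k := by exact_mod_cast hk
  have hp : (0 : ℝ) < (k : ℝ) ^ (p + 1) := by positivity
  rw [Real.norm_eq_abs, div_sub' hp.ne', abs_div, abs_of_pos hp, div_le_div_iff₀ hp hk0]
  have := mul_le_mul_of_nonneg_right (hu k hk) hk0.le
  rw [mul_comm (_ ^ _) a]
  calc _ ≤ _ := this
    _ = _ := by ring

section Asymptotics

variable {H T : ℕ → ℝ} {Q r : ℝ}

theorem tendsto_time_div_sq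
    (hT : ∀ k : ℕ, |T (k + 1) - T k - √17 * (Q + 2 * r * k)| ≤ 4 * √17) :
    Tendsto (fun k : ℕ => T k / (k : ℝ) ^ 2) atTop (𝓝 (√17 * r)) := by
  have h17 : (0 : ℝ) < √17 := by positivity
  -- Telescoping: the sum of Q + 2rj over j < k is Qk + rk(k - 1), and the errors add up linearly.
  have key : ∀ k : ℕ, |T k - T 0 - √17 * (Q * k + r * k * (k - 1))| ≤ 4 * √17 * k := fun k => by
    induction k with
    | zero => simp
    | succ k ih =>
      have h1 := hT k
      rw [abs_le] at *
      push_cast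
      constructor <;> nlinarith
  refine tendsto_div_of_abs_sub_le (p := 1)
    (C := |T 0| + √17 * (|Q| + |r|) + 4 * √17) fun k hk => ?_
  have hk0 : (1 : ℝ) ≤ k := by exact_mod_cast hk
  have e : T k - √17 * r * (k : ℝ) ^ (1 + 1) =
      (T k - T 0 - √17 * (Q * k + r * k * (k - 1))) + (T 0 + √17 * ((Q - r) * k)) := by ring
  rw [e]
  refine (abs_add_le _ _).trans ?_
  have h1 : |T 0 + √17 * ((Q - r) * k)| ≤ |T 0| + √17 * ((|Q| + |r|) * k) := by
    refine (abs_add_le _ _).trans ?_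
    rw [abs_mul, abs_mul, abs_of_pos h17, abs_of_pos (by linarith : (0 : ℝ) < k)]
    gcongr
    exact abs_sub _ _
  have h2 : |T 0| ≤ |T 0| * k := le_mul_of_one_le_right (abs_nonneg _) hk0
  have := key k
  rw [pow_one]
  nlinarith

theorem tendsto_height_div (hH : ∀ k : ℕ, |2 * H k - (Q + 2 * r * k)| ≤ 3) :
    Tendsto (fun k : ℕ => H k / (k : ℝ)) atTop (𝓝 r) := by
  have := tendsto_div_of_abs_sub_le (u := H) (a := r) (C := (3 + |Q|) / 2) (p := 0) fun k _ => by
    have h1 := hH k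
    have h2 := neg_abs_le Q
    have h3 := le_abs_self Q
    rw [abs_le] at *
    simp only [zero_add, pow_one, pow_zero, mul_one]
    constructor <;> linarith
  simpa using this

theorem div_sqrt_sqrt_mul (hr : 0 < r) : r / √(√17 * r) = √(r / √17) := by
  rw [Real.sqrt_mul (by positivity), Real.sqrt_div hr.le]
  have h1 : √r ≠ 0 := by positivity
  have h2 : √(√17) ≠ 0 := by positivity
  field_simp
  rw [Real.sq_sqrt hr.le]

theorem tendsto_atTop_of_tendsto_div_sq (hr : 0 < r)
    (hT : Tendsto (fun k : ℕ => T k / (k : ℝ) ^ 2) atTop (𝓝 r)) : Tendsto T atTop atTop := by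
  have h1 : Tendsto (fun k : ℕ => (k : ℝ) ^ 2) atTop atTop :=
    (tendsto_pow_atTop two_ne_zero).comp tendsto_natCast_atTop_atTop
  refine (hT.pos_mul_atTop hr h1).congr' ?_
  filter_upwards [eventually_ge_atTop 1] with k hk
  have hk0 : (0 : ℝ) < k := by exact_mod_cast hk
  field_simp

theorem sqrt_eq_mul_sqrt_div_sq {x k : ℝ} (hk : 0 < k) : √x = k * √(x / k ^ 2) := by
  rw [Real.sqrt_div' _ (by positivity), Real.sqrt_sq hk.le]
  field_simp

/-- Sandwich between the values along a sequence of times of quadratic growth. -/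
theorem tendsto_div_sqrt_of_sandwich {f : ℝ → ℝ} (hr : 0 < r) (h0 : ∀ k, 0 ≤ H k)
    (hH : ∀ k : ℕ, |2 * H k - (Q + 2 * r * k)| ≤ 3)
    (hT : ∀ k : ℕ, |T (k + 1) - T k - √17 * (Q + 2 * r * k)| ≤ 4 * √17)
    (hf : ∀ k t, T k ≤ t → t < T (k + 1) → H k ≤ f t ∧ f t ≤ H (k + 1)) :
    Tendsto (fun t => f t / √t) atTop (𝓝 √(r / √17)) := by
  have h17 : (0 : ℝ) < √17 := by positivity
  have hT2 := tendsto_time_div_sq hT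
  have hTtop := tendsto_atTop_of_tendsto_div_sq (by positivity) hT2
  have hH1 := tendsto_height_div hH
  have hT3 : Tendsto (fun k : ℕ => √(T k / (k : ℝ) ^ 2)) atTop (𝓝 √(√17 * r)) :=
    (Real.continuous_sqrt.tendsto _).comp hT2
  have hne : √(√17 * r) ≠ 0 := by positivity
  have hshift : Tendsto (fun k : ℕ => k + 1) atTop atTop := tendsto_add_atTop_nat 1
  have hq : Tendsto (fun k : ℕ => (((k + 1 : ℕ) : ℝ) / k)) atTop (𝓝 1) := by
    have : Tendsto (fun k : ℕ => 1 + 1 / (k : ℝ)) atTop (𝓝 (1 + 0)) :=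
      tendsto_const_nhds.add (tendsto_const_div_atTop_nhds_zero_nat 1)
    rw [add_zero] at this
    refine this.congr' ?_
    filter_upwards [eventually_ge_atTop 1] with k hk
    have hk0 : (0 : ℝ) < k := by exact_mod_cast hk
    push_cast
    field_simp
  have hlow : Tendsto (fun k => H k / √(T (k + 1))) atTop (𝓝 √(r / √17)) := by
    have := (hH1.div (hT3.comp hshift) hne).div hq one_ne_zero
    rw [div_one, div_sqrt_sqrt_mul hr] at this
    refine this.congr' ?_
    filter_upwards [eventually_ge_atTop 1] with k hk
    have hk0 : (0 : ℝ) < k := by exact_mod_cast hk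
    have hk1 : (0 : ℝ) < (k + 1 : ℕ) := by positivity
    simp only [Function.comp_apply, Pi.div_apply]
    rw [sqrt_eq_mul_sqrt_div_sq (x := T (k + 1)) hk1]
    field_simp
  have hupp : Tendsto (fun k => H (k + 1) / √(T k)) atTop (𝓝 √(r / √17)) := by
    have := ((hH1.comp hshift).mul hq).div hT3 hne
    rw [mul_one, div_sqrt_sqrt_mul hr] at this
    refine this.congr' ?_
    filter_upwards [eventually_ge_atTop 1] with k hk
    have hk0 : (0 : ℝ) < k := by exact_mod_cast hk
    have hk1 : (0 : ℝ) < (k + 1 : ℕ) := by positivity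
    simp only [Function.comp_apply, Pi.div_apply]
    rw [sqrt_eq_mul_sqrt_div_sq (x := T k) hk0]
    field_simp
  -- The index of a round containing t; the hypothesis on t sits inside so that the choice `κ` is
  -- total.
  have hk : ∀ t, ∃ k, T 0 ≤ t → T k ≤ t ∧ t < T (k + 1) := fun t => by
    classical
    by_cases h1 : T 0 ≤ t
    · have hex : ∃ k, t < T k := (hTtop.eventually_gt_atTop t).exists
      have hpos : Nat.find hex ≠ 0 := fun h2 => by
        have := Nat.find_spec hex
        rw [h2] at this
        linarith
      obtain ⟨k, hk⟩ := Nat.exists_eq_succ_of_ne_zero hpos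
      refine ⟨k, fun _ => ⟨?_, ?_⟩⟩
      · exact not_lt.1 (Nat.find_min hex (by omega))
      · have := Nat.find_spec hex
        rwa [hk] at this
    · exact ⟨0, fun h => absurd h h1⟩
  choose κ hκ using hk
  have hκtop : Tendsto κ atTop atTop := by
    refine tendsto_atTop.2 fun K => ?_
    have : ∀ᶠ t in atTop, ∀ j ∈ Finset.range (K + 1), T j ≤ t :=
      (Finset.eventually_all _).2 fun j _ => eventually_ge_atTop (T j)
    filter_upwards [this] with t ht
    by_contra! hlt
    have h1 := hκ t (ht 0 (by simp))
    have h2 := ht (κ t + 1) (by simp; omega)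
    linarith
  refine tendsto_of_tendsto_of_tendsto_of_le_of_le' (hlow.comp hκtop) (hupp.comp hκtop) ?_ ?_
  · filter_upwards [eventually_ge_atTop (T 0), eventually_gt_atTop 0] with t ht ht0
    obtain ⟨h1, h2⟩ := hκ t ht
    have h3 := hf _ t h1 h2
    have : 0 < √t := by positivity
    exact div_le_div₀ ((h0 _).trans h3.1) h3.1 this (Real.sqrt_le_sqrt h2.le)
  · filter_upwards [eventually_ge_atTop (T 0), eventually_gt_atTop 0,
      hκtop.eventually (hTtop.eventually_gt_atTop 0)] with t ht ht0 hpos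
    obtain ⟨h1, h2⟩ := hκ t ht
    have h3 := hf _ t h1 h2
    have : 0 < √(T (κ t)) := Real.sqrt_pos.2 hpos
    exact div_le_div₀ (h0 _) h3.2 this (Real.sqrt_le_sqrt h1)

end Asymptotics

/-- Nonemptiness matters because the infimum of the empty set of naturals is 0. -/
theorem height_anti {K : ℕ} {η η' : Config K} (h : η ⊆ η') (hη : η.Nonempty) :
    height η' ≤ height η := by
  obtain ⟨z, hz⟩ := hη
  exact csInf_le_csInf (OrderBot.bddBelow _) ⟨z.2, z, hz, rfl⟩
    fun n ⟨w, hw, hn⟩ => ⟨w, h hw, hn⟩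

theorem WellFilled.exists_full {K : ℕ} {η : Config K} (hη : WellFilled η) :
    ∃ N : ℕ, ∀ z : Fin K × ℕ, N ≤ z.2 → z ∈ η := by
  obtain ⟨M, hM⟩ := (hη.image Prod.snd).bddAbove
  refine ⟨M + 1, fun z hz => ?_⟩
  by_contra hne
  have := hM (mem_image_of_mem Prod.snd hne)
  omega

variable {h : ℝ} {η : Config 2} {s : State 2} {τ φ y : ℝ}

/-- Collision times are monotone and unbounded along the rounds, so they diverge. Configurations
only shrink, so the height at any time lies between its values at the ends of the current round. -/
theorem Generic.tendsto_height (h_nonneg : 0 ≤ h) (h_lt : h < 1 / 10) (hs : Generic h s)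
    (hη : WellFilled η) (hA : Along h s τ (unfolded φ y 1 η)) (hy : -h ≤ y) (hm : y ≤ 0)
    (hstart : y < 0 ∨ (column (φ + 4 * (0 - y)), 0) ∉ η) :
    Tendsto (s.time h) atTop atTop ∧
      Tendsto (fun t : ℝ => (height (flow h t s).config : ℝ) / √t) atTop
        (𝓝 √((1 - 4 * h) / √17)) := by
  have h17 : (0 : ℝ) < √17 := by positivity
  obtain ⟨N, hN⟩ := hη.exists_full
  obtain ⟨τ₁, φ₁, h1, h2⟩ := hA.exists_gapFrom (m := 0) hs hN (fun _ _ => Nat.zero_le _)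
    N.zero_le hy (by simpa using hm) (by simpa using hstart)
  obtain ⟨i, hi1, hi2⟩ := exists_column_index (φ := φ₁) fun k => by
    simpa using (hs.along h2).phase_ne_int (d := 0) (a := N) (b := 0) (Or.inr rfl) (by simp) k
  have hR := h2.floor hs (emptyBelow_gapFrom N _) h1 le_rfl
  obtain ⟨n, hn⟩ := Regime.exists_sequence h_nonneg h_lt hs hR
    (Or.inl ⟨N, i, φ₁, h1, hi1, hi2, rfl, rfl⟩)
  have e : (2 - 8 * h) = 2 * (1 - 4 * h) := by ring
  rw [e] at hn
  have hr : 0 < 1 - 4 * h := by linarith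
  have hT := tendsto_atTop_of_tendsto_div_sq (by positivity)
    (tendsto_time_div_sq (T := fun k => s.time h (n k)) fun k => (hn k).2.2)
  have htime : Tendsto (s.time h) atTop atTop :=
    tendsto_atTop_atTop_of_monotone s.time_monotone fun b => by
      obtain ⟨k, hk⟩ := (hT.eventually_ge_atTop b).exists
      exact ⟨n k, hk⟩
  refine ⟨htime, ?_⟩
  refine tendsto_div_sqrt_of_sandwich hr
    (H := fun k => (height (s.after h (n k)).config : ℝ)) (T := fun k => s.time h (n k))
    (fun k => Nat.cast_nonneg _) (fun k => (hn k).2.1) (fun k => (hn k).2.2) fun k t h3 h4 => ?_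
  have hcfg : (flow h t s).config =
      (s.after h (sSup {n : ℕ | s.time h n ≤ t})).config := rfl
  have hub : ∀ j ∈ {n : ℕ | s.time h n ≤ t}, j ≤ n (k + 1) := fun j hj => by
    by_contra! hlt
    have := s.time_monotone (h := h) hlt.le
    have hj' : s.time h j ≤ t := hj
    linarith
  have hle : n k ≤ sSup {n : ℕ | s.time h n ≤ t} := le_csSup ⟨_, hub⟩ h3
  have hle' : sSup {n : ℕ | s.time h n ≤ t} ≤ n (k + 1) := csSup_le ⟨_, h3⟩ hub
  have hsub := s.config_after_antitone (h := h) hle'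
  rw [hcfg]
  constructor
  · exact_mod_cast height_anti (s.config_after_antitone (h := h) hle)
      ((hn (k + 1)).1.mono hsub)
  · exact_mod_cast height_anti hsub (hn (k + 1)).1

end

/-! ### Almost every initial position. -/

section

theorem cos_sin_of_tan_eq {θ : ℝ} (hθ : Real.tan θ = 1 / 4) :
    (Real.cos θ = 4 / √17 ∧ Real.sin θ = 1 / √17) ∨
      (Real.cos θ = -(4 / √17) ∧ Real.sin θ = -(1 / √17)) := by
  have h17 : (0 : ℝ) < √17 := by positivity
  have hc : Real.cos θ ≠ 0 := fun h0 => by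
    rw [Real.tan_eq_sin_div_cos, h0, div_zero] at hθ
    norm_num at hθ
  have hs : Real.sin θ = Real.cos θ / 4 := by
    rw [Real.tan_eq_sin_div_cos, div_eq_iff hc] at hθ
    rw [hθ]; ring
  have h1 := Real.sin_sq_add_cos_sq θ
  rw [hs] at h1
  have h2 : (Real.cos θ) ^ 2 = (4 / √17) ^ 2 := by
    rw [div_pow, Real.sq_sqrt (by norm_num)]
    linarith
  rcases sq_eq_sq_iff_eq_or_eq_neg.1 h2 with h3 | h3
  · exact Or.inl ⟨h3, by rw [hs, h3]; ring⟩
  · exact Or.inr ⟨h3, by rw [hs, h3]; ring⟩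

theorem ae_line_ne (c : ℝ) : ∀ᵐ p : ℝ × ℝ, p.1 - 4 * p.2 ≠ c := by
  have hmeas : MeasurableSet {p : ℝ × ℝ | p.1 - 4 * p.2 = c} :=
    (isClosed_eq (by fun_prop) continuous_const).measurableSet
  rw [ae_iff]
  simp only [ne_eq, not_not]
  rw [Measure.volume_eq_prod, Measure.measure_prod_null hmeas]
  refine Eventually.of_forall fun x => ?_
  refine Set.Subsingleton.measure_zero (fun y hy y' hy' => ?_) _
  simp only [mem_preimage, mem_ofPred_eq] at hy hy'
  linarith

theorem ae_fst_ne (c : ℝ) : ∀ᵐ p : ℝ × ℝ, p.1 ≠ c :=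
  Measure.quasiMeasurePreserving_fst.ae (Measure.ae_ne volume c)

theorem ae_snd_ne (c : ℝ) : ∀ᵐ p : ℝ × ℝ, p.2 ≠ c :=
  Measure.quasiMeasurePreserving_snd.ae (Measure.ae_ne volume c)

/-- The bricks tile the strip above height 0, so initial positions lie below all rows, whatever
bricks are missing. For h = 0 there are none. -/
theorem snd_neg_of_mem_table_univ {h : ℝ} {p : ℝ × ℝ} (hp : p ∈ table h (univ : Config 2)) :
    p.2 < 0 := by
  by_contra! h0
  have h1 := hp.1
  simp only [strip, mem_ofPred_eq, Nat.cast_ofNat] at h1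
  have h2 := Nat.floor_le h0
  have h3 := (Nat.lt_floor_add_one p.2).le
  refine hp.2 (mem_biUnion (mem_univ ((if p.1 < 1 then 0 else 1 : Fin 2), ⌊p.2⌋₊)) ⟨?_, h2, h3⟩)
  split_ifs with h4
  · constructor <;> simp only [Fin.val_zero, Nat.cast_zero] <;> linarith
  · constructor <;> simp only [Fin.val_one, Nat.cast_one] <;> linarith

variable {h : ℝ} {η : Config 2}

/-- The velocity points strictly into the table: the free flight stays in the interior of the
table during a short interval of real times. -/
def State.PointsInward {K : ℕ} (h : ℝ) (s : State K) : Prop :=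
  ∃ ε : ℝ, 0 < ε ∧ ∀ t : ℝ, 0 < t → t < ε → s.pos + t • s.vel ∈ interior (table h s.config)

/-- The time in `State.Admissible` is elaborated as a natural number, so that only the position
matters there; `State.PointsInward` is the condition on the velocity for real times. -/
theorem admissible_iff {K : ℕ} {s : State K} : s.Admissible h ↔ s.pos ∈ table h s.config :=
  ⟨fun hs => hs.1, fun hs => ⟨hs, 1, one_pos, fun t h1 h2 => by omega⟩⟩

theorem Generic.regular {s : State 2} (hs : Generic h s) (hp : s.pos ∈ table h s.config)
    (ht : Tendsto (s.time h) atTop atTop) : s.Regular h :=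
  ⟨admissible_iff.2 hp, hs.hitPoint_notMem_vertices, ht⟩

theorem pointsInward_of_mem_interior {K : ℕ} {s : State K}
    (hp : s.pos ∈ interior (table h s.config)) : s.PointsInward h := by
  have hcont : Continuous fun t : ℝ => s.pos + t • s.vel := by fun_prop
  have hnhds : ∀ᶠ t in 𝓝 (0 : ℝ), s.pos + t • s.vel ∈ interior (table h s.config) :=
    hcont.continuousAt.eventually_mem (isOpen_interior.mem_nhds (by simpa using hp))
  obtain ⟨ε, hε, hball⟩ := Metric.eventually_nhds_iff.1 hnhds
  exact ⟨ε, hε, fun t h1 h2 => hball (by rw [Real.dist_eq, sub_zero, abs_of_pos h1]; exact h2)⟩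

theorem unfolded_of_right {x : ℝ} (hx : 0 < x) (hx' : x < 2) (y : ℝ) :
    unfolded x y 1 η = ⟨(x, y), (4 / √17, 1 / √17), η⟩ := by
  rw [unfolded, foldX_eq (j := 0) (by simpa using hx.le) (by simpa using hx'.le),
    dirX_eq (j := 0) (by simpa using hx.le) (by simpa using hx')]
  simp

theorem unfolded_of_left {x : ℝ} (hx : 0 < x) (hx' : x < 2) (y : ℝ) :
    unfolded (-x) y (-1) η = ⟨(x, y), (-(4 / √17), -(1 / √17)), η⟩ := by
  rw [unfolded, foldX_eq (j := -1) (by push_cast; linarith) (by push_cast; linarith),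
    dirX_eq (j := -1) (by push_cast; linarith) (by push_cast; linarith)]
  simp

/-- Almost every initial state is regular, points into the table, and has the stated growth. -/
theorem ae_regular_and_tendsto (h : ℝ) (h_nonneg : 0 ≤ h) (h_lt : h < 1 / 10)
    (θ₀ : ℝ) (hθ₀ : Real.tan θ₀ = 1 / 4) (η₀ : Config 2) (hη₀ : WellFilled η₀) :
    (∀ᵐ x₀ : ℝ × ℝ, x₀ ∈ table h (univ : Config 2) →
      (State.ofAngle x₀ η₀ θ₀).PointsInward h ∧ (State.ofAngle x₀ η₀ θ₀).Regular h ∧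
      Tendsto (fun t : ℝ => (height (flow h t (State.ofAngle x₀ η₀ θ₀)).config : ℝ) / √t)
        atTop (𝓝 (√((1 - 4 * h) / √17)))) ∧
    (0 < Real.sin θ₀ → ∀ᵐ x₁ : ℝ, (x₁, -h) ∈ table h η₀ →
      (State.ofAngle (x₁, -h) η₀ θ₀).PointsInward h ∧ (State.ofAngle (x₁, -h) η₀ θ₀).Regular h ∧
      Tendsto (fun t : ℝ => (height (flow h t (State.ofAngle (x₁, -h) η₀ θ₀)).config : ℝ) / √t)
        atTop (𝓝 (√((1 - 4 * h) / √17)))) := by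
  have h17 : (0 : ℝ) < √17 := by positivity
  have hη : EmptyBelow η₀ 0 := fun _ _ => Nat.zero_le _
  constructor
  · filter_upwards [ae_fst_ne 0, ae_fst_ne 2, ae_snd_ne (-h),
      ae_all_iff.2 fun a : ℤ => ae_all_iff.2 fun b : ℤ => ae_line_ne (a + 4 * h * b)]
      with ⟨x, y⟩ hx0 hx2 hyh hgen hxt
    have hy0 := snd_neg_of_mem_table_univ hxt
    have hst := hxt.1
    simp only [strip, mem_ofPred_eq, Nat.cast_ofNat] at hst hx0 hx2 hyh hgen hy0
    have hx0' : 0 < x := lt_of_le_of_ne hst.1 hx0.symm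
    have hx2' : x < 2 := lt_of_le_of_ne hst.2.1 hx2
    have hyh' : -h < y := lt_of_le_of_ne hst.2.2 hyh.symm
    have hint : (x, y) ∈ interior (table h η₀) :=
      hη.mem_interior hx0' hx2' hyh' (by simpa using hy0)
    have hpt : (x, y) ∈ table h η₀ := interior_subset hint
    have hadm : (State.ofAngle (x, y) η₀ θ₀).PointsInward h := pointsInward_of_mem_interior hint
    rcases cos_sin_of_tan_eq hθ₀ with ⟨hc, hs⟩ | ⟨hc, hs⟩
    · have heq : State.ofAngle (x, y) η₀ θ₀ = unfolded x y 1 η₀ := by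
        rw [unfolded_of_right hx0' hx2', State.ofAngle, hc, hs]
      have hG : Generic h (State.ofAngle (x, y) η₀ θ₀) :=
        ⟨1, 1, Or.inl rfl, Or.inl rfl, by simp [State.ofAngle, hc, hs], fun a b => by
          simpa [State.ofAngle] using hgen a b⟩
      have hA : Along h (State.ofAngle (x, y) η₀ θ₀) 0 (unfolded x y 1 η₀) := by
        rw [← heq]; exact (Reaches.refl _).along
      have := hG.tendsto_height h_nonneg h_lt hη₀ hA hyh'.le hy0.le (Or.inl hy0)
      exact ⟨hadm, hG.regular hpt this.1, this.2⟩
    · have heq : State.ofAngle (x, y) η₀ θ₀ = unfolded (-x) y (-1) η₀ := by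
        rw [unfolded_of_left hx0' hx2', State.ofAngle, hc, hs]
      have hG : Generic h (State.ofAngle (x, y) η₀ θ₀) :=
        ⟨-1, -1, Or.inr rfl, Or.inr rfl, by simp [State.ofAngle, hc, hs], fun a b hab => by
          refine hgen (-a) (-b) ?_
          simp only [State.ofAngle] at hab
          push_cast
          linarith⟩
      have hA : Along h (State.ofAngle (x, y) η₀ θ₀) 0 (unfolded (-x) y (-1) η₀) := by
        rw [← heq]; exact (Reaches.refl _).along
      -- The tangent also allows the opposite velocity; that ball first meets the floor and then
      -- starts upwards.
      have hF := hA.floor hG hη hyh' (by simpa using hy0.le)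
      have := hG.tendsto_height h_nonneg h_lt hη₀ hF.along le_rfl (by linarith)
        (Or.inl (by linarith))
      exact ⟨hadm, hG.regular hpt this.1, this.2⟩
  · intro hsin
    obtain ⟨hc, hs⟩ : Real.cos θ₀ = 4 / √17 ∧ Real.sin θ₀ = 1 / √17 := by
      refine (cos_sin_of_tan_eq hθ₀).resolve_right fun h1 => ?_
      have : 0 < 1 / √17 := by positivity
      linarith [h1.2]
    -- On the floor the invariant equals x + 4h. The values with b = 1 exclude integer x.
    filter_upwards [ae_all_iff.2 fun a : ℤ => ae_all_iff.2 fun b : ℤ =>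
      Measure.ae_ne volume (a + 4 * h * b - 4 * h)] with x hgen hxt
    have hst := hxt.1
    simp only [strip, mem_ofPred_eq, Nat.cast_ofNat] at hst
    have hint : ∀ k : ℤ, x ≠ k := fun k hk => hgen k 1 (by rw [hk]; push_cast; ring)
    have hx0' : 0 < x := lt_of_le_of_ne hst.1 fun h1 => hint 0 (by simpa using h1.symm)
    have hx2' : x < 2 := lt_of_le_of_ne hst.2.1 fun h1 => hint 2 (by simpa using h1)
    have heq : State.ofAngle (x, -h) η₀ θ₀ = unfolded x (-h) 1 η₀ := by
      rw [unfolded_of_right hx0' hx2', State.ofAngle, hc, hs]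
    have hG : Generic h (State.ofAngle (x, -h) η₀ θ₀) :=
      ⟨1, 1, Or.inl rfl, Or.inl rfl, by simp [State.ofAngle, hc, hs], fun a b hab => by
        refine hgen a b ?_
        simp only [State.ofAngle] at hab
        linarith⟩
    have hA : Along h (State.ofAngle (x, -h) η₀ θ₀) 0 (unfolded x (-h) 1 η₀) := by
      rw [← heq]; exact (Reaches.refl _).along
    have hfold : foldX x = x := by
      rw [foldX_eq (j := 0) (by simpa using hx0'.le) (by simpa using hx2'.le)]; simp
    have hcol := column_lt_foldX hint
    rw [hfold] at hcol
    -- For h = 0 the floor is level with the undersides of row 0, and membership in the table forces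
    -- the brick above the ball to be missing.
    have hstart : -h < 0 ∨ (column (x + 4 * (0 - -h)), 0) ∉ η₀ := by
      rcases h_nonneg.eq_or_lt with rfl | hpos
      · refine Or.inr fun hmem => hxt.2 (mem_biUnion hmem ?_)
        simp only [neg_zero, sub_self, mul_zero, add_zero]
        exact ⟨⟨hcol.1.le, hcol.2.le⟩, by simp, by simp⟩
      · exact Or.inl (by linarith)
    have hc1 : 4 / √17 < 1 := by
      rw [div_lt_one h17]; exact Real.lt_sqrt_of_sq_lt (by norm_num)
    have hc0 : 0 < 4 / √17 := by positivity
    have hs0 : 0 < 1 / √17 := by positivity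
    have hs1 : 1 / √17 < 1 := by
      refine lt_trans ?_ hc1
      gcongr; norm_num
    have hadm : (State.ofAngle (x, -h) η₀ θ₀).PointsInward h := by
      suffices ∃ ε : ℝ, 0 < ε ∧ ∀ t : ℝ, 0 < t → t < ε →
          (x + t * (4 / √17), -h + t * (1 / √17)) ∈ interior (table h η₀) by
        simpa only [State.PointsInward, State.ofAngle, hc, hs, Prod.smul_mk, Prod.mk_add_mk,
          smul_eq_mul] using this
      rcases h_nonneg.eq_or_lt with rfl | hpos
      · have hmem := hstart.resolve_left (by simp)
        simp only [neg_zero, sub_self, mul_zero, add_zero] at hmem ⊢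
        -- Only the ball's own column is known to be free, so the flight is stopped before its right
        -- end.
        refine ⟨column x + 1 - x, by linarith, fun t h1 h2 => ?_⟩
        have : (column x : ℝ) + 1 - x < 1 := by linarith
        refine hη.mem_interior_column hmem ?_ ?_ ?_ ?_ <;> push_cast <;> nlinarith
      · refine ⟨min h (2 - x), lt_min hpos (by linarith), fun t h1 h2 => ?_⟩
        have h3 := h2.trans_le (min_le_left _ _)
        have h4 := h2.trans_le (min_le_right _ _)
        refine hη.mem_interior ?_ ?_ ?_ ?_ <;> push_cast <;> nlinarith
    have := hG.tendsto_height h_nonneg h_lt hη₀ hA le_rfl (by linarith) hstart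
    exact ⟨hadm, hG.regular hxt this.1, this.2⟩

end

end Breakout

end

theorem mainTheorem1 (h : ℝ) (h_nonneg : 0 ≤ h) (h_lt : h < 1 / 10)
    (θ₀ : ℝ) (hθ₀ : Real.tan θ₀ = 1 / 4)
    (η₀ : Breakout.Config 2) (hη₀ : Breakout.WellFilled η₀) :
    -- almost every initial position in the strip below all bricks
    (∀ᵐ x₀ : ℝ × ℝ, x₀ ∈ Breakout.table h (Set.univ : Breakout.Config 2) →
      (Breakout.State.ofAngle x₀ η₀ θ₀).Regular h ∧
      Tendsto (fun t : ℝ =>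
          (Breakout.height (Breakout.flow h t (Breakout.State.ofAngle x₀ η₀ θ₀)).config : ℝ) / √t)
        atTop (𝓝 (√((1 - 4 * h) / √17)))) ∧
    -- almost every initial position on the floor, for an angle that points upwards
    (0 < Real.sin θ₀ → ∀ᵐ x₁ : ℝ, (x₁, -h) ∈ Breakout.table h η₀ →
      (Breakout.State.ofAngle (x₁, -h) η₀ θ₀).Regular h ∧
      Tendsto (fun t : ℝ =>
          (Breakout.height
            (Breakout.flow h t (Breakout.State.ofAngle (x₁, -h) η₀ θ₀)).config : ℝ) / √t)
        atTop (𝓝 (√((1 - 4 * h) / √17)))) := by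
  obtain ⟨h₁, h₂⟩ := Breakout.ae_regular_and_tendsto h h_nonneg h_lt θ₀ hθ₀ η₀ hη₀
  exact ⟨h₁.mono fun _ hx hxt => (hx hxt).2,
    fun hsin => (h₂ hsin).mono fun _ hx hxt => (hx hxt).2⟩
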